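/- **SW-categories.** A *category with subtraction* is a category $\mathcal C$ with a chosen initial object $\emptyset$, subcategories of cofibrations ($\hookrightarrow$) and of fibrations ($\xrightarrow{\circ}$), both containing the isomorphisms, and a collection of *subtraction sequences* $Z\hookrightarrow X\xleftarrow{\circ}Y$ (one writes $Y=X-Z$), such that: pullbacks along cofibrations and along fibrations exist, and cofibrations, fibrations and subtraction sequences are stable under base change; $A\to A\amalg B\leftarrow B$ is a subtraction sequence; every cofibration (resp. fibration) is part of a subtraction sequence whose remaining leg is unique up to unique isomorphism; and subtraction is functorial in fibre squares of cofibrations (resp. of fibrations): for a fibre square of cofibrations $W=X\times_Y Z$ there are unique induced maps $X-W\to Y-Z$ and $Z-W\to Y-X$, and the pullback $Q=(Y-Z)\times_Y(Y-X)$ completes them to subtraction sequences $X-W\hookrightarrow Y-Z\xleftarrow{\circ}Q$ and $Z-W\hookrightarrow Y-X\xleftarrow{\circ}Q$; dually for fibrations. It is *subtractive* if pushouts of spans of cofibrations exist, their legs are again cofibrations and these pushout squares are cartesian; for every cartesian square of cofibrations $W=X\times_Z Y$ the map $X\amalg_W Y\to Z$ is a cofibration; and, given a map of spans of cofibrations from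 $X'\hookleftarrow W'\hookrightarrow Y'$ to $X\hookleftarrow W\hookrightarrow Y$ with both squares cartesian, and a map to the latter from a span of cofibrations $X''\hookleftarrow W''\hookrightarrow Y''$, such that $X'\hookrightarrow X\xleftarrow{\circ}X''$, $W'\hookrightarrow W\xleftarrow{\circ}W''$ and $Y'\hookrightarrow Y\xleftarrow{\circ}Y''$ are subtraction sequences, the induced maps $X'\amalg_{W'}Y'\to X\amalg_W Y\leftarrow X''\amalg_{W''}Y''$ form a subtraction sequence. An *SW-category* is a subtractive category with a subcategory of weak equivalences, containing the isomorphisms, such that a levelwise weak equivalence of spans of cofibrations induces a weak equivalence on pushouts, and a commutative square from $Z\hookrightarrow X$ to $Z'\hookrightarrow X'$ whose maps $Z\to Z'$ and $X\to X'$ are weak equivalences induces a weak equivalence $X-Z\to X'-Z'$. **The K-theory space.** Let $\widetilde{\mathrm{Ar}}[n]\subset[n]^{op}\times[n]$ be the full subcategory of the pairs $(i,j)$ with $i\le j$. An object of $\widetilde S_n\mathcal C$ is a functor $X:\widetilde{\mathrm{Ar}}[n]\to\mathcal C$ with $X_{ii}=\emptyset$, with $X_{ij}\to X_{ik}$ a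 cofibration and $X_{ij}\hookrightarrow X_{ik}\xleftarrow{\circ}X_{jk}$ a subtraction sequence for $i\le j\le k$, and such that for $i\le j\le k\le l$ the square formed by $X_{jk}\to X_{jl}$ and $X_{ik}\to X_{il}$ is cartesian. A morphism of $w\widetilde S_n\mathcal C$ is a natural transformation that consists of weak equivalences and whose squares over the maps $X_{ij}\to X_{ik}$ are cartesian. (In a category with subtraction it is equivalent to ask for the cartesian squares only for $i<j<k<l$, respectively only in the row $i=0$.) Precomposition makes $w\widetilde S_\bullet\mathcal C$ a simplicial category; $w_\bullet\widetilde S_\bullet\mathcal C$ is its levelwise nerve, $|w_\bullet\widetilde S_\bullet\mathcal C|$ the realization of this bisimplicial set, based at the vertex $\emptyset$, and $K(\mathcal C)=\Omega|w_\bullet\widetilde S_\bullet\mathcal C|$. **The Grothendieck group.** $K_0(\mathcal C)$ is the abelian group generated by the objects of $\mathcal C$, with relations $[X]=[X']$ for every weak equivalence $X\to X'$ and $[Y]=[X]+[Y-X]$ for every subtraction sequence $X\hookrightarrow Y\xleftarrow{\circ}Y-X$. If the weak equivalences are the isomorphisms, this is the group generated by the isomorphism classes of objects subject to $[Y]=[X]+[Y-X]$.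 **Theorem.** (1) For every SW-category $\mathcal C$ there is a bijection $$\pi_0K(\mathcal C)\;\cong\;K_0(\mathcal C)$$ which is a group isomorphism for the group structure on $\pi_0K(\mathcal C)$ given by concatenation of loops, and which sends the component of the loop given by an object $X$ (i.e. by the flag $\emptyset\to X\leftarrow\emptyset$ in $\widetilde S_1\mathcal C$) to $[X]$. (2) Let $X$ be a scheme and let $\mathbf{Var}_{/X}$ be the category of separated $X$-schemes of finite type, with the closed immersions as cofibrations, the open immersions as fibrations, the isomorphisms as weak equivalences, and as subtraction sequences the $Z\hookrightarrow Y\xleftarrow{\circ}U$ with $Z\hookrightarrow Y$ a closed and $U\to Y$ an open immersion such that the underlying set of $Y$ is the disjoint union of those of $Z$ and $U$. With $K$ and $K_0$ defined by the same constructions, $\pi_0K(\mathbf{Var}_{/X})\cong K_0(\mathbf{Var}_{/X})$ in the same sense: $\pi_0K(\mathbf{Var}_{/X})$ is the abelian group generated by the isomorphism classes of varieties over $X$ subject to $[Y]=[Z]+[U]$ for all these subtraction sequences. -/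

import Mathlib

open CategoryTheory CategoryTheory.Limits Opposite AlgebraicGeometry
open scoped Simplicial

universe w v u

/-! ## Subtractive Waldhausen categories -/

/-- The data of a (candidate) subtractive Waldhausen category on a category `C`: an object `∅`,
subcategories of cofibrations, fibrations and weak equivalences (each containing all identities),
and a collection of subtraction sequences `Z ⟶ X ⟵ Y`, which contains `∅ = ∅ = ∅`.
The axioms are stated in `SWData.IsSWCategory`. -/
structure SWData (C : Type u) [Category.{v} C] where
  /-- the empty object -/
  empty : C
  /-- cofibrations -/
  cof : MorphismProperty C
  /-- fibrations -/
  fib : MorphismProperty C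
  /-- weak equivalences -/
  weq : MorphismProperty C
  /-- `sub i j` says that `i : Z ⟶ X` and `j : Y ⟶ X` form a subtraction sequence `Z ⟶ X ⟵ Y`. -/
  sub : ∀ ⦃Z X Y : C⦄, (Z ⟶ X) → (Y ⟶ X) → Prop
  cof_mult : cof.IsMultiplicative
  fib_mult : fib.IsMultiplicative
  weq_mult : weq.IsMultiplicative
  sub_empty : sub (𝟙 empty) (𝟙 empty)

namespace SWData

variable {C : Type u} [Category.{v} C] (S : SWData C)

/-- Categories with subtraction. -/
structure IsCategoryWithSubtraction : Prop where
  isInitial : Nonempty (IsInitial S.empty)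
  iso_cof : MorphismProperty.isomorphisms C ≤ S.cof
  iso_fib : MorphismProperty.isomorphisms C ≤ S.fib
  cof_hasPullback : ∀ ⦃Z X W : C⦄ (i : Z ⟶ X) (g : W ⟶ X), S.cof i → HasPullback i g
  fib_hasPullback : ∀ ⦃Y X W : C⦄ (j : Y ⟶ X) (g : W ⟶ X), S.fib j → HasPullback j g
  cof_baseChange : S.cof.IsStableUnderBaseChange
  fib_baseChange : S.fib.IsStableUnderBaseChange
  /-- The legs of a subtraction sequence are a cofibration and a fibration. -/
  sub_cof : ∀ ⦃Z X Y : C⦄ (i : Z ⟶ X) (j : Y ⟶ X), S.sub i j → S.cof i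
  sub_fib : ∀ ⦃Z X Y : C⦄ (i : Z ⟶ X) (j : Y ⟶ X), S.sub i j → S.fib j
  /-- `A ⟶ A ⨿ B ⟵ B` is a subtraction sequence. -/
  sub_coprod : ∀ ⦃A B : C⦄ (c : BinaryCofan A B), Nonempty (IsColimit c) → S.sub c.inl c.inr
  /-- Every cofibration is part of a subtraction sequence, unique up to unique isomorphism. -/
  exists_of_cof : ∀ ⦃Z X : C⦄ (i : Z ⟶ X), S.cof i → ∃ (Y : C) (j : Y ⟶ X), S.sub i j
  unique_of_cof : ∀ ⦃Z X Y Y' : C⦄ (i : Z ⟶ X) (j : Y ⟶ X) (j' : Y' ⟶ X),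
    S.sub i j → S.sub i j' → ∃! e : Y ≅ Y', e.hom ≫ j' = j
  /-- Every fibration is part of a subtraction sequence, unique up to unique isomorphism. -/
  exists_of_fib : ∀ ⦃Y X : C⦄ (j : Y ⟶ X), S.fib j → ∃ (Z : C) (i : Z ⟶ X), S.sub i j
  unique_of_fib : ∀ ⦃Z Z' X Y : C⦄ (i : Z ⟶ X) (i' : Z' ⟶ X) (j : Y ⟶ X),
    S.sub i j → S.sub i' j → ∃! e : Z ≅ Z', e.hom ≫ i' = i
  /-- Functoriality of subtraction in fibre squares of cofibrations: for a cartesian square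
  `W ⟶ X`, `W ⟶ Z` over `Y` of cofibrations and complements `XW = X - W`, `YZ = Y - Z`,
  `ZW = Z - W`, `YX = Y - X`, there are unique induced maps `XW ⟶ YZ` and `ZW ⟶ YX`, and the
  cartesian square on `YZ ⟶ Y ⟵ YX` completes both to subtraction sequences. -/
  sub_square_cof : ∀ ⦃W X Z Y XW YZ ZW YX : C⦄ (a : W ⟶ X) (b : W ⟶ Z) (d : X ⟶ Y) (c : Z ⟶ Y)
    (j₁ : XW ⟶ X) (j₂ : YZ ⟶ Y) (k₁ : ZW ⟶ Z) (k₂ : YX ⟶ Y),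
    IsPullback a b d c → S.cof a → S.cof b → S.cof d → S.cof c →
    S.sub a j₁ → S.sub c j₂ → S.sub b k₁ → S.sub d k₂ →
    ∃ (p : XW ⟶ YZ) (q : ZW ⟶ YX) (Q : C) (r : Q ⟶ YZ) (s : Q ⟶ YX),
      p ≫ j₂ = j₁ ≫ d ∧ (∀ p' : XW ⟶ YZ, p' ≫ j₂ = j₁ ≫ d → p' = p) ∧
      q ≫ k₂ = k₁ ≫ c ∧ (∀ q' : ZW ⟶ YX, q' ≫ k₂ = k₁ ≫ c → q' = q) ∧
      IsPullback r s j₂ k₂ ∧ S.sub p r ∧ S.sub q s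
  /-- The dual statement for fibre squares of fibrations. -/
  sub_square_fib : ∀ ⦃W X Z Y XW YZ ZW YX : C⦄ (a : W ⟶ X) (b : W ⟶ Z) (d : X ⟶ Y) (c : Z ⟶ Y)
    (j₁ : XW ⟶ X) (j₂ : YZ ⟶ Y) (k₁ : ZW ⟶ Z) (k₂ : YX ⟶ Y),
    IsPullback a b d c → S.fib a → S.fib b → S.fib d → S.fib c →
    S.sub j₁ a → S.sub j₂ c → S.sub k₁ b → S.sub k₂ d →
    ∃ (p : XW ⟶ YZ) (q : ZW ⟶ YX) (Q : C) (r : Q ⟶ YZ) (s : Q ⟶ YX),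
      p ≫ j₂ = j₁ ≫ d ∧ (∀ p' : XW ⟶ YZ, p' ≫ j₂ = j₁ ≫ d → p' = p) ∧
      q ≫ k₂ = k₁ ≫ c ∧ (∀ q' : ZW ⟶ YX, q' ≫ k₂ = k₁ ≫ c → q' = q) ∧
      IsPullback r s j₂ k₂ ∧ S.sub r p ∧ S.sub s q
  /-- Subtraction sequences are stable under base change. -/
  sub_baseChange : ∀ ⦃Z X Y W Z' Y' : C⦄ (i : Z ⟶ X) (j : Y ⟶ X) (g : W ⟶ X)
    (i' : Z' ⟶ W) (z : Z' ⟶ Z) (j' : Y' ⟶ W) (y : Y' ⟶ Y),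
    S.sub i j → IsPullback i' z g i → IsPullback j' y g j → S.sub i' j'

/-- Subtractive categories. -/
structure IsSubtractive : Prop extends S.IsCategoryWithSubtraction where
  cof_hasPushout : ∀ ⦃W X Y : C⦄ (f : W ⟶ X) (g : W ⟶ Y), S.cof f → S.cof g → HasPushout f g
  cof_cobaseChange : ∀ ⦃W X Y P : C⦄ (f : W ⟶ X) (g : W ⟶ Y) (h : X ⟶ P) (k : Y ⟶ P),
    S.cof f → S.cof g → IsPushout f g h k → S.cof h ∧ S.cof k
  cocartesian_cartesian : ∀ ⦃W X Y P : C⦄ (f : W ⟶ X) (g : W ⟶ Y) (h : X ⟶ P) (k : Y ⟶ P),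
    S.cof f → S.cof g → IsPushout f g h k → IsPullback f g h k
  /-- pushout products -/
  cof_pushoutProduct : ∀ ⦃W X Y Z P : C⦄ (f : W ⟶ X) (g : W ⟶ Y) (h : X ⟶ Z) (k : Y ⟶ Z)
    (h' : X ⟶ P) (k' : Y ⟶ P) (m : P ⟶ Z),
    IsPullback f g h k → S.cof f → S.cof g → S.cof h → S.cof k →
    IsPushout f g h' k' → h' ≫ m = h → k' ≫ m = k → S.cof m
  /-- subtraction and pushouts: the columns are the subtraction sequences
  `X' ⟶ X ⟵ X''`, `W' ⟶ W ⟵ W''` and `Y' ⟶ Y ⟵ Y''` -/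
  sub_pushout : ∀ ⦃X' W' Y' X W Y X'' W'' Y'' P' P P'' : C⦄
    (f' : W' ⟶ X') (g' : W' ⟶ Y') (f : W ⟶ X) (g : W ⟶ Y) (f'' : W'' ⟶ X'') (g'' : W'' ⟶ Y'')
    (x' : X' ⟶ X) (w' : W' ⟶ W) (y' : Y' ⟶ Y) (x'' : X'' ⟶ X) (w'' : W'' ⟶ W) (y'' : Y'' ⟶ Y)
    (h' : X' ⟶ P') (k' : Y' ⟶ P') (h : X ⟶ P) (k : Y ⟶ P) (h'' : X'' ⟶ P'') (k'' : Y'' ⟶ P'')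
    (m' : P' ⟶ P) (m'' : P'' ⟶ P),
    S.cof f' → S.cof g' → S.cof f → S.cof g → S.cof f'' → S.cof g'' →
    S.sub x' x'' → S.sub w' w'' → S.sub y' y'' →
    IsPullback f' w' x' f → IsPullback g' w' y' g →
    f'' ≫ x'' = w'' ≫ f → g'' ≫ y'' = w'' ≫ g →
    IsPushout f' g' h' k' → IsPushout f g h k → IsPushout f'' g'' h'' k'' →
    h' ≫ m' = x' ≫ h → k' ≫ m' = y' ≫ k → h'' ≫ m'' = x'' ≫ h → k'' ≫ m'' = y'' ≫ k →
    S.sub m' m''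

/-- Subtractive Waldhausen categories (SW-categories). -/
structure IsSWCategory : Prop extends S.IsSubtractive where
  iso_weq : MorphismProperty.isomorphisms C ≤ S.weq
  /-- gluing -/
  weq_gluing : ∀ ⦃X Y Z X' Y' Z' P P' : C⦄ (f : X ⟶ Y) (g : X ⟶ Z) (f' : X' ⟶ Y') (g' : X' ⟶ Z')
    (x : X ⟶ X') (y : Y ⟶ Y') (z : Z ⟶ Z')
    (h : Y ⟶ P) (k : Z ⟶ P) (h' : Y' ⟶ P') (k' : Z' ⟶ P') (m : P ⟶ P'),
    S.cof f → S.cof g → S.cof f' → S.cof g' → S.weq x → S.weq y → S.weq z →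
    f ≫ y = x ≫ f' → g ≫ z = x ≫ g' → IsPushout f g h k → IsPushout f' g' h' k' →
    h ≫ m = y ≫ h' → k ≫ m = z ≫ k' → S.weq m
  /-- Weak equivalences respect subtraction. -/
  weq_sub : ∀ ⦃Z X Y Z' X' Y' : C⦄ (i : Z ⟶ X) (j : Y ⟶ X) (i' : Z' ⟶ X') (j' : Y' ⟶ X')
    (z : Z ⟶ Z') (x : X ⟶ X'), S.sub i j → S.sub i' j' → S.weq z → S.weq x →
    i ≫ x = z ≫ i' → ∃ y : Y ⟶ Y', y ≫ j' = j ≫ x ∧ S.weq y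

/-! ## The Grothendieck group -/

/-- The defining relations of the Grothendieck group: weakly equivalent objects are identified,
and `[X] = [Z] + [Y]` for every subtraction sequence `Z ⟶ X ⟵ Y`. -/
def k0Relations : Set (FreeAbelianGroup C) :=
  {r | ∃ (X X' : C) (f : X ⟶ X'), S.weq f ∧
      r = FreeAbelianGroup.of X - FreeAbelianGroup.of X'} ∪
  {r | ∃ (Z X Y : C) (i : Z ⟶ X) (j : Y ⟶ X), S.sub i j ∧
      r = FreeAbelianGroup.of X - (FreeAbelianGroup.of Z + FreeAbelianGroup.of Y)}

/-- The Grothendieck group `K₀`. -/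
abbrev K0 : Type u := FreeAbelianGroup C ⧸ AddSubgroup.closure S.k0Relations

/-- The class `[X]` of an object in `K₀`. -/
def k0Class (X : C) : S.K0 := QuotientAddGroup.mk (FreeAbelianGroup.of X)

/-! ## The `S̃`-construction -/

end SWData

/-- The category of pairs `(i, j)` with `i ≤ j` in `[n]`, as a full subcategory of `[n]ᵒᵖ × [n]`:
there is a (unique) map `(i, j) ⟶ (i', j')` iff `i' ≤ i` and `j ≤ j'`. -/
abbrev FlagIndex (n : SimplexCategory) : Type :=
  {p : (Fin (n.len + 1))ᵒᵈ × Fin (n.len + 1) // OrderDual.ofDual p.1 ≤ p.2}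

namespace FlagIndex

variable {n : SimplexCategory}

/-- The pair `(i, j)`. -/
def mk {i j : Fin (n.len + 1)} (h : i ≤ j) : FlagIndex n := ⟨(OrderDual.toDual i, j), h⟩

/-- The map `(i, j) ⟶ (i, k)` for `i ≤ j ≤ k`. -/
def right {i j k : Fin (n.len + 1)} (hij : i ≤ j) (hjk : j ≤ k) :
    mk hij ⟶ mk (hij.trans hjk) :=
  homOfLE ⟨le_rfl, hjk⟩

/-- The map `(j, k) ⟶ (i, k)` for `i ≤ j ≤ k`. -/
def up {i j k : Fin (n.len + 1)} (hij : i ≤ j) (hjk : j ≤ k) :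
    mk hjk ⟶ mk (hij.trans hjk) :=
  homOfLE ⟨OrderDual.toDual_le_toDual.mpr hij, le_rfl⟩

/-- The functor induced by a monotone map `[m] → [n]`. -/
def map {m n : SimplexCategory} (f : m ⟶ n) : FlagIndex m ⥤ FlagIndex n :=
  Monotone.functor (f := fun p => ⟨(OrderDual.toDual (f.toOrderHom (OrderDual.ofDual p.1.1)),
      f.toOrderHom p.1.2), f.toOrderHom.monotone p.2⟩)
    (fun _ _ h => ⟨f.toOrderHom.monotone h.1, f.toOrderHom.monotone h.2⟩)

end FlagIndex

namespace SWData

variable {C : Type u} [Category.{v} C] (S : SWData C)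

/-- The objects of `S̃ₙ C`. The degenerate instances of the conditions (equalities among the
indices) hold automatically in an SW-category, see
`IsCategoryWithSubtraction.cartesian_of_strict`; they are
included so that visibly every monotone map acts. -/
structure STilde (n : SimplexCategory) where
  /-- the flag `X` -/
  flag : FlagIndex n ⥤ C
  flag_empty : ∀ i : Fin (n.len + 1), flag.obj (FlagIndex.mk (le_refl i)) = S.empty
  flag_cof : ∀ {i j k : Fin (n.len + 1)} (hij : i ≤ j) (hjk : j ≤ k),
    S.cof (flag.map (FlagIndex.right hij hjk))
  flag_sub : ∀ {i j k : Fin (n.len + 1)} (hij : i ≤ j) (hjk : j ≤ k),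
    S.sub (flag.map (FlagIndex.right hij hjk)) (flag.map (FlagIndex.up hij hjk))
  flag_cart : ∀ {i j k l : Fin (n.len + 1)} (hij : i ≤ j) (hjk : j ≤ k) (hkl : k ≤ l),
    IsPullback (flag.map (FlagIndex.right hjk hkl)) (flag.map (FlagIndex.up hij hjk))
      (flag.map (FlagIndex.up hij (hjk.trans hkl))) (flag.map (FlagIndex.right (hij.trans hjk) hkl))

namespace STilde

variable {S} {n : SimplexCategory}

/-- Morphisms of `w S̃ₙ C`: natural transformations which are levelwise weak equivalences, and
whose squares over the horizontal maps `(i, j) ⟶ (i, k)` are cartesian. (In an SW-category it is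
enough to ask this for `i = 0`, see
`IsCategoryWithSubtraction.cartesian_of_row_zero`.) -/
@[ext]
structure Hom (X Y : STilde S n) where
  /-- the underlying natural transformation -/
  nat : X.flag ⟶ Y.flag
  cart : ∀ {i j k : Fin (n.len + 1)} (hij : i ≤ j) (hjk : j ≤ k),
    IsPullback (X.flag.map (FlagIndex.right hij hjk)) (nat.app _) (nat.app _)
      (Y.flag.map (FlagIndex.right hij hjk))
  weq : ∀ a, S.weq (nat.app a)

/-- The category `w S̃ₙ C`. -/
instance : Category (STilde S n) where
  Hom := Hom
  id X :=
    { nat := 𝟙 X.flag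
      cart := fun _ _ => IsPullback.of_vert_isIso ⟨by simp⟩
      weq := fun a => S.weq_mult.id_mem _ }
  comp f g :=
    { nat := f.nat ≫ g.nat
      cart := fun hij hjk => by
        simpa using IsPullback.paste_vert (f.cart hij hjk) (g.cart hij hjk)
      weq := fun a => S.weq_mult.comp_mem _ _ (f.weq a) (g.weq a) }
  id_comp f := Hom.ext (Category.id_comp f.nat)
  comp_id f := Hom.ext (Category.comp_id f.nat)
  assoc f g h := Hom.ext (Category.assoc f.nat g.nat h.nat)

/-- The functor `w S̃ₙ C ⥤ w S̃ₘ C` given by precomposition with a monotone map `[m] → [n]`. For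
`[n-1] → [n]` missing `k`, it deletes the `k`-th row and column; for `[n+1] → [n]` hitting `k`
twice, it inserts identities. -/
def pull {m n : SimplexCategory} (f : m ⟶ n) : STilde S n ⥤ STilde S m where
  obj X :=
    { flag := FlagIndex.map f ⋙ X.flag
      flag_empty := fun i => X.flag_empty (f.toOrderHom i)
      flag_cof := fun hij hjk => X.flag_cof (f.toOrderHom.monotone hij) (f.toOrderHom.monotone hjk)
      flag_sub := fun hij hjk => X.flag_sub (f.toOrderHom.monotone hij) (f.toOrderHom.monotone hjk)
      flag_cart := fun hij hjk hkl => X.flag_cart (f.toOrderHom.monotone hij)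
        (f.toOrderHom.monotone hjk) (f.toOrderHom.monotone hkl) }
  map τ :=
    { nat := Functor.whiskerLeft (FlagIndex.map f) τ.nat
      cart := fun hij hjk => τ.cart (f.toOrderHom.monotone hij) (f.toOrderHom.monotone hjk)
      weq := fun a => τ.weq _ }

end STilde

/-! The following facts show that in a category with subtraction the conditions in `STilde` and
`STilde.Hom` reduce to those with strict inequalities, respectively to those on the first row. -/

namespace IsCategoryWithSubtraction

lemma mono_of_cof {S : SWData C} (h : S.IsCategoryWithSubtraction) {Z X : C} (i : Z ⟶ X)
    (hi : S.cof i) : Mono i := by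
  have := h.cof_hasPullback i i hi
  have := h.cof_baseChange
  have hc : S.cof (pullback.fst i i ≫ i) := S.cof_mult.comp_mem _ _
    (MorphismProperty.of_isPullback (IsPullback.of_hasPullback i i).flip hi) hi
  obtain ⟨Y, j, hj⟩ := h.exists_of_cof _ hc
  have hs := (h.unique_of_fib _ _ j hj hj).unique (y₁ := pullbackSymmetry i i)
    (y₂ := Iso.refl _) (by simp [pullback.condition]) (by simp)
  have hfs : pullback.snd i i = pullback.fst i i := by
    rw [← pullbackSymmetry_hom_comp_fst, hs]; simp
  refine ⟨fun a b hab => ?_⟩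
  rw [← pullback.lift_fst a b hab, ← hfs, pullback.lift_snd]

lemma mono_of_fib {S : SWData C} (h : S.IsCategoryWithSubtraction) {Y X : C} (j : Y ⟶ X)
    (hj : S.fib j) : Mono j := by
  have := h.fib_hasPullback j j hj
  have := h.fib_baseChange
  have hc : S.fib (pullback.fst j j ≫ j) := S.fib_mult.comp_mem _ _
    (MorphismProperty.of_isPullback (IsPullback.of_hasPullback j j).flip hj) hj
  obtain ⟨Z, i, hi⟩ := h.exists_of_fib _ hc
  have hs := (h.unique_of_cof i _ _ hi hi).unique (y₁ := pullbackSymmetry j j)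
    (y₂ := Iso.refl _) (by simp [pullback.condition]) (by simp)
  have hfs : pullback.snd j j = pullback.fst j j := by
    rw [← pullbackSymmetry_hom_comp_fst, hs]; simp
  refine ⟨fun a b hab => ?_⟩
  rw [← pullback.lift_fst a b hab, ← hfs, pullback.lift_snd]

/-- The two legs of a subtraction sequence are disjoint. -/
lemma isPullback_of_sub {S : SWData C} (h : S.IsCategoryWithSubtraction) {Z X Y E : C}
    (i : Z ⟶ X) (j : Y ⟶ X) (hij : S.sub i j) (hE : IsInitial E) (a : E ⟶ Z) (b : E ⟶ Y) :
    IsPullback a b i j := by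
  have := h.mono_of_cof i (h.sub_cof i j hij)
  have := h.cof_hasPullback i j (h.sub_cof i j hij)
  have h1 : S.sub (𝟙 Z) (pullback.fst i j) :=
    h.sub_baseChange i j i (𝟙 Z) (𝟙 Z) (pullback.fst i j) (pullback.snd i j) hij
      (IsKernelPair.id_of_mono i) (IsPullback.of_hasPullback i j)
  have h2 : S.sub (𝟙 Z) a := h.sub_coprod (BinaryCofan.mk (𝟙 Z) a)
    ⟨BinaryCofan.IsColimit.mk _ (fun f _ => f) (fun _ _ => Category.id_comp _)
      (fun _ _ => hE.hom_ext _ _) (fun f g m hm _ => (Category.id_comp m).symm.trans hm)⟩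
  obtain ⟨e, -, -⟩ := h.unique_of_cof _ _ _ h2 h1
  exact IsPullback.of_iso_pullback ⟨hE.hom_ext _ _⟩ e (hE.hom_ext _ _) (hE.hom_ext _ _)

lemma cartesian_of_strict {S : SWData C} (h : S.IsCategoryWithSubtraction) {n : SimplexCategory}
    (F : FlagIndex n ⥤ C)
    (hempty : ∀ i : Fin (n.len + 1), F.obj (FlagIndex.mk (le_refl i)) = S.empty)
    (hsub : ∀ {i j k : Fin (n.len + 1)} (hij : i ≤ j) (hjk : j ≤ k),
      S.sub (F.map (FlagIndex.right hij hjk)) (F.map (FlagIndex.up hij hjk)))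
    (hcart : ∀ {i j k l : Fin (n.len + 1)} (hij : i < j) (hjk : j < k) (hkl : k < l),
      IsPullback (F.map (FlagIndex.right hjk.le hkl.le)) (F.map (FlagIndex.up hij.le hjk.le))
        (F.map (FlagIndex.up hij.le (hjk.trans hkl).le))
        (F.map (FlagIndex.right (hij.trans hjk).le hkl.le)))
    {i j k l : Fin (n.len + 1)} (hij : i ≤ j) (hjk : j ≤ k) (hkl : k ≤ l) :
    IsPullback (F.map (FlagIndex.right hjk hkl)) (F.map (FlagIndex.up hij hjk))
      (F.map (FlagIndex.up hij (hjk.trans hkl)))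
      (F.map (FlagIndex.right (hij.trans hjk) hkl)) := by
  have hid : ∀ {a : FlagIndex n} (f : a ⟶ a), IsIso (F.map f) := fun f => by
    rw [Subsingleton.elim f (𝟙 _)]; infer_instance
  have hcomm : CommSq (F.map (FlagIndex.right hjk hkl)) (F.map (FlagIndex.up hij hjk))
      (F.map (FlagIndex.up hij (hjk.trans hkl)))
      (F.map (FlagIndex.right (hij.trans hjk) hkl)) :=
    ⟨by rw [← F.map_comp, ← F.map_comp]; exact congrArg F.map (Subsingleton.elim _ _)⟩
  obtain rfl | hij' := hij.eq_or_lt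
  · have := hid (FlagIndex.up hij hjk)
    have := hid (FlagIndex.up hij (hjk.trans hkl))
    exact IsPullback.of_vert_isIso hcomm
  obtain rfl | hkl' := hkl.eq_or_lt
  · have := hid (FlagIndex.right hjk hkl)
    have := hid (FlagIndex.right (hij.trans hjk) hkl)
    exact IsPullback.of_horiz_isIso hcomm
  obtain rfl | hjk' := hjk.eq_or_lt
  · obtain ⟨hE⟩ := h.isInitial
    exact (h.isPullback_of_sub _ _ (hsub hij hkl) (hE.ofIso (eqToIso (hempty j).symm)) _ _).flip
  exact hcart hij' hjk' hkl'

lemma cartesian_of_row_zero {S : SWData C} (h : S.IsCategoryWithSubtraction) {n : SimplexCategory}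
    {X Y : STilde S n} (τ : X.flag ⟶ Y.flag)
    (hτ : ∀ {j k : Fin (n.len + 1)} (hjk : j ≤ k),
      IsPullback (X.flag.map (FlagIndex.right (Fin.zero_le j) hjk)) (τ.app _) (τ.app _)
        (Y.flag.map (FlagIndex.right (Fin.zero_le j) hjk)))
    {i j k : Fin (n.len + 1)} (hij : i ≤ j) (hjk : j ≤ k) :
    IsPullback (X.flag.map (FlagIndex.right hij hjk)) (τ.app _) (τ.app _)
      (Y.flag.map (FlagIndex.right hij hjk)) := by
  have key : ∀ {j : Fin (n.len + 1)} (hij : i ≤ j),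
      IsPullback (X.flag.map (FlagIndex.up (Fin.zero_le i) hij)) (τ.app _) (τ.app _)
        (Y.flag.map (FlagIndex.up (Fin.zero_le i) hij)) := by
    intro j hij
    have hs := Y.flag_sub (Fin.zero_le i) hij
    have hf := h.sub_fib _ _ hs
    have := h.mono_of_fib _ hf
    have := h.fib_hasPullback _ (τ.app (FlagIndex.mk ((Fin.zero_le i).trans hij))) hf
    have := hasPullback_symmetry (Y.flag.map (FlagIndex.up (Fin.zero_le i) hij))
      (τ.app (FlagIndex.mk ((Fin.zero_le i).trans hij)))
    have hP := h.sub_baseChange _ _ _ _ _ _ _ hs (hτ hij) (IsPullback.of_hasPullback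
      (τ.app (FlagIndex.mk ((Fin.zero_le i).trans hij)))
      (Y.flag.map (FlagIndex.up (Fin.zero_le i) hij)))
    obtain ⟨e, he, -⟩ := h.unique_of_cof _ _ _ (X.flag_sub (Fin.zero_le i) hij) hP
    refine IsPullback.of_iso_pullback ⟨τ.naturality _⟩ e he ?_
    rw [← cancel_mono (Y.flag.map (FlagIndex.up (Fin.zero_le i) hij)), Category.assoc,
      ← pullback.condition, ← Category.assoc, he, τ.naturality]
  have hcomp : ∀ F : FlagIndex n ⥤ C,
      F.map (FlagIndex.right hij hjk) ≫ F.map (FlagIndex.up (Fin.zero_le i) (hij.trans hjk)) =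
      F.map (FlagIndex.up (Fin.zero_le i) hij) ≫
        F.map (FlagIndex.right (Fin.zero_le j) hjk) := fun F => by
    rw [← F.map_comp, ← F.map_comp]; exact congrArg F.map (Subsingleton.elim _ _)
  refine IsPullback.of_right ?_ (τ.naturality _) (key (hij.trans hjk))
  rw [hcomp, hcomp]
  exact (key hij).paste_horiz (hτ hjk)

end IsCategoryWithSubtraction

/-- The simplicial category `w S̃_• C`. -/
def wSTilde : SimplexCategoryᵒᵖ ⥤ Cat.{v, max u v} where
  obj n := Cat.of (STilde S n.unop)
  map f := (STilde.pull f.unop).toCatHom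
  map_id _ := rfl
  map_comp _ _ := rfl

/-- The bisimplicial set `w_• S̃_• C`, the levelwise nerve of `w S̃_• C`. -/
def wSTildeNerve : SimplexCategoryᵒᵖ ⥤ SSet.{max u v} := S.wSTilde ⋙ nerveFunctor

end SWData

/-- The diagonal of a bisimplicial set. -/
def bisimplicialDiagonal (X : SimplexCategoryᵒᵖ ⥤ SSet.{u}) : SSet.{u} where
  obj n := (X.obj n).obj n
  map f := (X.map f).app _ ≫ (X.obj _).map f
  map_id n := by simp
  map_comp f g := by simp

/-- The geometric realization of a bisimplicial set, as the realization of its diagonal. -/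
noncomputable def bisimplicialRealization (X : SimplexCategoryᵒᵖ ⥤ SSet.{u}) : TopCat.{u} :=
  SSet.toTop.obj (bisimplicialDiagonal X)

/-- The point of the realization given by a vertex of a simplicial set. -/
noncomputable def realizationVertex {K : SSet.{u}} (x : K _⦋0⦌) : SSet.toTop.obj K :=
  TopCat.toSSetObj₀Equiv ((sSetTopAdj.unit.app K).app _ x)

/-- The path in the realization, affinely parametrized, given by an edge of a simplicial set. -/
noncomputable def realizationPath {K : SSet.{u}} {x y : K _⦋0⦌} (e : SSet.Edge x y) :
    Path (realizationVertex x) (realizationVertex y) :=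
  TopCat.pathEquiv (TopCat.toSSetObjEdgeEquiv
    (SSet.Edge.mk (e.map (sSetTopAdj.unit.app K)).edge
      (by rw [SSet.Edge.src_eq]; exact (Equiv.symm_apply_apply _ _).symm)
      (by rw [SSet.Edge.tgt_eq]; exact (Equiv.symm_apply_apply _ _).symm)))

namespace SWData

variable {C : Type u} [Category.{v} C] (S : SWData C)

/-! ## The K-theory space -/

/-- The object of `S̃₀ C`, given by the flag `∅`. -/
def flagZero : STilde S ⦋0⦌ where
  flag := (Functor.const _).obj S.empty
  flag_empty _ := rfl
  flag_cof _ _ := S.cof_mult.id_mem _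
  flag_sub _ _ := S.sub_empty
  flag_cart _ _ _ := IsPullback.of_id_fst

/-- `S̃₀ C` has only one object. -/
lemma eq_flagZero (A : STilde S ⦋0⦌) : A = S.flagZero := by
  have key : A.flag = (Functor.const _).obj S.empty := by
    have hobj : ∀ a : FlagIndex ⦋0⦌, A.flag.obj a = S.empty := by
      rintro ⟨⟨i, j⟩, h⟩
      obtain rfl : OrderDual.ofDual i = j := Subsingleton.elim (α := Fin 1) _ _
      exact A.flag_empty _
    refine CategoryTheory.Functor.ext hobj ?_
    rintro ⟨⟨i, j⟩, h⟩ ⟨⟨i', j'⟩, h'⟩ f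
    obtain rfl : i = i' := Subsingleton.elim (α := Fin 1) _ _
    obtain rfl : j = j' := Subsingleton.elim (α := Fin 1) _ _
    obtain rfl : f = 𝟙 _ := Subsingleton.elim _ _
    simp
  obtain ⟨F, h1, h2, h3, h4⟩ := A
  obtain rfl : F = (Functor.const _).obj S.empty := key
  rfl

/-- The space `|w_• S̃_• C|`. -/
noncomputable abbrev wSTildeSpace : TopCat.{max u v} := bisimplicialRealization S.wSTildeNerve

/-- The unique vertex of the diagonal of `w_• S̃_• C`. -/
def baseVertex : (bisimplicialDiagonal S.wSTildeNerve) _⦋0⦌ :=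
  ComposableArrows.mk₀ (C := STilde S ⦋0⦌) S.flagZero

lemma eq_baseVertex (x : (bisimplicialDiagonal S.wSTildeNerve) _⦋0⦌) : x = S.baseVertex :=
  ComposableArrows.ext₀ (C := STilde S ⦋0⦌) (S.eq_flagZero _)

/-- The base point of `|w_• S̃_• C|`. -/
noncomputable def basePoint : S.wSTildeSpace := realizationVertex S.baseVertex

/-- The K-theory space `K(C) = Ω|w_• S̃_• C|`. -/
abbrev KSpace : Type (max u v) := LoopSpace S.wSTildeSpace S.basePoint

/-- The edge of the diagonal of `w_• S̃_• C` given by the identity of an object `A` of `S̃₁ C`. -/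
def baseEdge (A : STilde S ⦋1⦌) : SSet.Edge S.baseVertex S.baseVertex :=
  SSet.Edge.mk (X := bisimplicialDiagonal S.wSTildeNerve)
    (ComposableArrows.mk₁ (C := STilde S ⦋1⦌) (𝟙 A)) (S.eq_baseVertex _) (S.eq_baseVertex _)

/-- The loop in `|w_• S̃_• C|` given by an object `A` of `S̃₁ C`. -/
noncomputable def edgeLoop (A : STilde S ⦋1⦌) : S.KSpace := realizationPath (S.baseEdge A)

/-- `π₀ K(C) = K₀(C)`: there is a bijection from the set of path components of the loop space
`K(C)` to the Grothendieck group `K₀(C)`, which is a group isomorphism for the group structure on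
`π₀ K(C)` given by concatenation of loops, and which sends the component of the loop given by an
object `X = A₀₁` of `C` (regarded as the flag `∅ ⟶ X ⟵ ∅`) to its class `[X]`. -/
def PiZeroKSpaceEqKZero : Prop :=
  ∃ e : ZerothHomotopy S.KSpace ≃ S.K0,
    (∀ γ δ : S.KSpace, e (ZerothHomotopy.mk (γ.trans δ)) =
      e (ZerothHomotopy.mk γ) + e (ZerothHomotopy.mk δ)) ∧
    ∀ A : STilde S ⦋1⦌, e (ZerothHomotopy.mk (S.edgeLoop A)) =
      S.k0Class (A.flag.obj (FlagIndex.mk (i := 0) (j := 1) zero_le_one))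

end SWData

/-! ## Varieties -/

/-- `X`-schemes which are separated and of finite type. -/
def isVariety (X : Scheme.{u}) : ObjectProperty (Over X) := fun Y =>
  LocallyOfFiniteType Y.hom ∧ QuasiCompact Y.hom ∧ IsSeparated Y.hom

/-- The category `Var_{/X}` of varieties over `X`. -/
abbrev Var (X : Scheme.{u}) : Type (u + 1) := (isVariety X).FullSubcategory

/-- The functor which forgets the structure morphism to `X`. -/
abbrev Var.forget (X : Scheme.{u}) : Var X ⥤ Scheme.{u} := (isVariety X).ι ⋙ Over.forget X

/-- The empty variety. -/
noncomputable def Var.empty (X : Scheme.{u}) : Var X where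
  obj := Over.mk (Scheme.emptyTo X)
  property := by
    refine ⟨?_, ?_, ?_⟩ <;> dsimp <;> infer_instance

/-- `Var_{/X}` with the closed immersions as cofibrations, the open immersions as fibrations,
the isomorphisms as weak equivalences, and as subtraction sequences the `Z ⟶ Y ⟵ U` with `Z ⟶ Y` a
closed immersion and `U ⟶ Y` an open immersion such that the underlying set of `Y` is the
disjoint union of those of `Z` and `U`. -/
noncomputable def varSWData (X : Scheme.{u}) : SWData (Var X) where
  empty := Var.empty X
  cof := MorphismProperty.inverseImage @IsClosedImmersion (Var.forget X)
  fib := MorphismProperty.inverseImage @IsOpenImmersion (Var.forget X)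
  weq := MorphismProperty.isomorphisms (Var X)
  sub _ _ _ i j := IsClosedImmersion ((Var.forget X).map i) ∧ IsOpenImmersion ((Var.forget X).map j) ∧
    IsCompl (Set.range ((Var.forget X).map i)) (Set.range ((Var.forget X).map j))
  cof_mult :=
    { id_mem := fun Y => inferInstanceAs (IsClosedImmersion (𝟙 Y.obj.left))
      comp_mem := fun f g (hf : IsClosedImmersion f.hom.left) (hg : IsClosedImmersion g.hom.left) =>
        inferInstanceAs (IsClosedImmersion (f.hom.left ≫ g.hom.left)) }
  fib_mult :=
    { id_mem := fun Y => inferInstanceAs (IsOpenImmersion (𝟙 Y.obj.left))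
      comp_mem := fun f g (hf : IsOpenImmersion f.hom.left) (hg : IsOpenImmersion g.hom.left) =>
        inferInstanceAs (IsOpenImmersion (f.hom.left ≫ g.hom.left)) }
  weq_mult := inferInstance
  sub_empty := by
    have : IsEmpty ((Var.forget X).obj (Var.empty X)) := inferInstanceAs (IsEmpty (∅ : Scheme.{u}))
    rw [CategoryTheory.Functor.map_id]
    refine ⟨inferInstance, inferInstance, ?_⟩
    exact ⟨disjoint_iff.mpr (Subsingleton.elim _ _), codisjoint_iff.mpr (Subsingleton.elim _ _)⟩

/-! The diagonal of the bisimplicial set has a single vertex, so the components of the loop space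
form the fundamental group of the realization. Two mutually inverse homomorphisms between this group
and `K0` are needed.

From `K0` to loops: an object gives an edge and hence a class `objClass`. A subtraction sequence `Z
⟶ X ⟵ Y` is a flag of length two, and the 2-simplex constant at this flag gives [X] = [Z][Y]. A
general edge of the diagonal is a morphism `A ⟶ B` of flags; triangles that are degenerate in the
flag direction show that its class is that of `A` and also that of `B` (`eq_edgeClass`), so weakly
equivalent objects have equal classes. The sum of `X` and `Y` is the middle term of a sequence in
either order, so classes of objects commute.

The classes of edges generate (`loop_induction`). This rests on `path_induction`: up to homotopy,
every path is composed of paths inside simplices. The proof is an induction over skeleta in which a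
path is pushed radially away from the centres of the top-dimensional cells. The point-set topology
needed for it is controlled by normal forms: every point lies in the interior of exactly one
nondegenerate simplex.

From loops to `K0`: the class of the source is an additive function on edges, and any additive
function φ with values in an abelian group `H` extends to a homomorphism
(`exists_hom_of_isAdditive`). In place of a presentation of the fundamental group there is an
explicit classifying map. The point with barycentric coordinates t of a simplex goes to the step
function on [0, 1) whose value on the i-th interval, of length tᵢ, is φ of the edge from vertex 0 to
vertex i. Modulo constants this depends only on the point of the realization. Step functions modulo
constants have `StepFun H` as a covering with group `H`, and monodromy is the homomorphism.

All of this uses only the properties in `IsPresubtractive`. They are isolated because varieties do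
not satisfy all axioms of an SW-category: a closed subset carries several scheme structures, so
uniqueness of the closed complement fails in general. -/

namespace stdSimplex

/-! ### Points of simplices and their faces -/

lemma map_apply_eq_sum {X Y : Type*} [Fintype X] [Fintype Y] [DecidableEq Y] (f : X → Y)
    (t : stdSimplex ℝ X) (y : Y) : map f t y = ∑ x with f x = y, t x := by
  rw [map_coe, FunOnFinite.linearMap_apply_apply]

lemma map_apply_of_injective {X Y : Type*} [Fintype X] [Fintype Y] {f : X → Y}
    (hf : Function.Injective f) (t : stdSimplex ℝ X) (x : X) : map f t (f x) = t x := by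
  classical
  rw [map_apply_eq_sum]
  have : ({x' | f x' = f x} : Finset X) = {x} := by ext; simp [hf.eq_iff]
  rw [this, Finset.sum_singleton]

lemma map_apply_eq_zero {X Y : Type*} [Fintype X] [Fintype Y] {f : X → Y}
    (t : stdSimplex ℝ X) {y : Y} (hy : y ∉ Set.range f) : map f t y = 0 := by
  classical
  rw [map_apply_eq_sum, Finset.sum_eq_zero]
  intro x hx
  exact absurd ⟨x, (Finset.mem_filter.1 hx).2⟩ hy

lemma map_apply_pos {X Y : Type*} [Fintype X] [Fintype Y] {f : X → Y}
    (t : stdSimplex ℝ X) (ht : ∀ x, 0 < t x) {y : Y} (hy : y ∈ Set.range f) : 0 < map f t y := by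
  classical
  obtain ⟨x, rfl⟩ := hy
  rw [map_apply_eq_sum]
  exact Finset.sum_pos (fun x _ => ht x) ⟨x, by simp⟩

/-- Every point of a simplex is an interior point of a face. -/
lemma exists_eq_map_of_pos {n : ℕ} (t : stdSimplex ℝ (Fin (n + 1))) :
    ∃ (k : ℕ) (d : Fin (k + 1) → Fin (n + 1)) (t₀ : stdSimplex ℝ (Fin (k + 1))),
      StrictMono d ∧ (∀ i, 0 < t₀ i) ∧ t = map d t₀ := by
  let s : Finset (Fin (n + 1)) := {i | 0 < t i}
  have hs0 : ∀ i ∉ s, t i = 0 := fun i hi =>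
    le_antisymm (not_lt.1 fun h => hi (by simpa [s] using h)) (zero_le t i)
  have hs : s.card ≠ 0 := by
    intro h
    rw [Finset.card_eq_zero] at h
    have := sum_eq_one t
    rw [Finset.sum_eq_zero (fun i _ => hs0 i (by simp [h]))] at this
    exact zero_ne_one this
  obtain ⟨k, hk⟩ := Nat.exists_eq_succ_of_ne_zero hs
  let d := s.orderEmbOfFin hk
  have hsum : ∑ i, t (d i) = 1 := by
    rw [← sum_eq_one t, ← Finset.sum_subset (Finset.subset_univ s) (fun i _ hi => hs0 i hi)]
    have := Finset.sum_map Finset.univ (d.toEmbedding) (fun i => t i)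
    rw [← Finset.map_orderEmbOfFin_univ s hk]
    exact this.symm
  refine ⟨k, d, ⟨fun i => t (d i), fun i => zero_le t _, hsum⟩, d.strictMono, fun i => ?_, ?_⟩
  · have : d i ∈ s := Finset.orderEmbOfFin_mem s hk i
    exact (Finset.mem_filter.1 this).2
  · ext j
    by_cases hj : j ∈ Set.range d
    · obtain ⟨i, rfl⟩ := hj
      rw [map_apply_of_injective d.injective]
      rfl
    · rw [map_apply_eq_zero _ hj]
      refine hs0 j fun h => hj ?_
      rw [Finset.range_orderEmbOfFin]
      exact h

/-- The support of the point is the range of the face map, and a strictly monotone map is determined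
by its range. -/
lemma eq_of_map_eq_map {n k l : ℕ} {d : Fin (k + 1) → Fin (n + 1)} {d' : Fin (l + 1) → Fin (n + 1)}
    (hd : StrictMono d) (hd' : StrictMono d') {t : stdSimplex ℝ (Fin (k + 1))}
    {t' : stdSimplex ℝ (Fin (l + 1))} (ht : ∀ i, 0 < t i) (ht' : ∀ i, 0 < t' i)
    (h : map d t = map d' t') : ∃ hkl : k = l, d = d' ∘ Fin.cast (by rw [hkl]) ∧
      ∀ i, t i = t' (Fin.cast (by rw [hkl]) i) := by
  have hr : Set.range d = Set.range d' := by
    ext j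
    constructor
    · intro hj
      by_contra hj'
      have := map_apply_pos t ht hj
      rw [h, map_apply_eq_zero _ hj'] at this
      exact lt_irrefl _ this
    · intro hj
      by_contra hj'
      have := map_apply_pos t' ht' hj
      rw [← h, map_apply_eq_zero _ hj'] at this
      exact lt_irrefl _ this
  obtain rfl : k = l := by
    have h1 := Set.card_range_of_injective hd.injective
    have h2 := Set.card_range_of_injective hd'.injective
    simp only [hr, Fintype.card_fin] at h1 h2
    simp only [Fintype.card_eq_nat_card] at h1 h2
    omega
  obtain rfl : d = d' := (hd.range_inj hd').1 hr
  refine ⟨rfl, rfl, fun i => ?_⟩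
  rw [← map_apply_of_injective hd.injective t, h, map_apply_of_injective hd.injective]
  rfl

end stdSimplex

/-! ### Characteristic maps and the universal property of the realization -/

namespace Realization

/-- The characteristic map of a simplex. -/
noncomputable def cellMap {K : SSet.{u}} {n : SimplexCategory} (σ : K.obj (op n)) :
    C(stdSimplex ℝ (Fin (n.len + 1)), SSet.toTop.obj K) :=
  TopCat.toSSetObjEquiv _ _ ((sSetTopAdj.unit.app K).app _ σ)

lemma cellMap_map {K : SSet.{u}} {m n : SimplexCategory} (f : m ⟶ n) (σ : K.obj (op n))
    (t : stdSimplex ℝ (Fin (m.len + 1))) :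
    cellMap (K.map f.op σ) t = cellMap σ (stdSimplex.map f t) := by
  have h := ConcreteCategory.congr_hom ((sSetTopAdj.unit.app K).naturality f.op) σ
  exact congrArg (fun x => TopCat.toSSetObjEquiv _ _ x t) h

/-- A compatible family of maps on the topological simplices. -/
noncomputable def toSingular {K : SSet.{u}} {Y : TopCat.{u}}
    (φ : ∀ ⦃n : SimplexCategory⦄, K.obj (op n) → C(stdSimplex ℝ (Fin (n.len + 1)), Y))
    (hφ : ∀ ⦃m n : SimplexCategory⦄ (f : m ⟶ n) (σ : K.obj (op n)) t,
      φ (K.map f.op σ) t = φ σ (stdSimplex.map f t)) : K ⟶ TopCat.toSSet.obj Y where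
  app n := TypeCat.ofHom fun σ => (TopCat.toSSetObjEquiv _ _).symm (φ (n := n.unop) σ)
  naturality m n f := by
    ext σ
    apply (TopCat.toSSetObjEquiv _ _).injective
    ext t
    exact hφ f.unop σ t

/-- The adjunction between realization and singular complex, in pointwise form: a compatible family
is a map to the singular complex. -/
lemma exists_desc {K : SSet.{u}} {Y : TopCat.{u}}
    (φ : ∀ ⦃n : SimplexCategory⦄, K.obj (op n) → C(stdSimplex ℝ (Fin (n.len + 1)), Y))
    (hφ : ∀ ⦃m n : SimplexCategory⦄ (f : m ⟶ n) (σ : K.obj (op n)) t,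
      φ (K.map f.op σ) t = φ σ (stdSimplex.map f t)) :
    ∃ F : SSet.toTop.obj K ⟶ Y, ∀ {n : SimplexCategory} (σ : K.obj (op n)) t,
      F (cellMap σ t) = φ σ t := by
  refine ⟨(sSetTopAdj.homEquiv _ _).symm (toSingular φ hφ), fun {n} σ t => ?_⟩
  have h := sSetTopAdj.homEquiv_unit (X := K) (Y := Y)
    (f := (sSetTopAdj.homEquiv _ _).symm (toSingular φ hφ))
  rw [Equiv.apply_symm_apply] at h
  have h2 := ConcreteCategory.congr_hom (NatTrans.congr_app h (op n)) σ
  have h3 := congrArg (fun x => TopCat.toSSetObjEquiv _ _ x t) h2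
  simp [toSingular] at h3
  rw [h3]
  rfl

lemma toTop_hom_ext {K : SSet.{u}} {Y : TopCat.{u}} {F G : SSet.toTop.obj K ⟶ Y}
    (h : ∀ {n : SimplexCategory} (σ : K.obj (op n)) t, F (cellMap σ t) = G (cellMap σ t)) :
    F = G := by
  apply (sSetTopAdj.homEquiv _ _).injective
  rw [Adjunction.homEquiv_unit, Adjunction.homEquiv_unit]
  ext n σ
  apply (TopCat.toSSetObjEquiv _ _).injective
  ext t
  exact h (n := n.unop) σ t

end Realization

/-! ### Normal forms of points -/

namespace Realization

/-- A nondegenerate simplex together with a point of the corresponding topological simplex. -/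
abbrev CellPoint (K : SSet.{u}) : Type u :=
  Σ n : ℕ, K.nonDegenerate n × stdSimplex ℝ (Fin (n + 1))

/-- `y` is the normal form of the point `t` of the simplex `σ`: it is obtained by passing to the
face which has `t` in its interior and collapsing this face to a nondegenerate simplex. -/
def IsNormalForm {K : SSet.{u}} {n : SimplexCategory} (σ : K.obj (op n))
    (t : stdSimplex ℝ (Fin (n.len + 1))) (y : CellPoint K) : Prop :=
  ∃ (k : ℕ) (d : ⦋k⦌ ⟶ n) (e : ⦋k⦌ ⟶ ⦋y.1⦌) (t₀ : stdSimplex ℝ (Fin (k + 1))),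
    Mono d ∧ Epi e ∧ (∀ i, 0 < t₀ i) ∧ stdSimplex.map d t₀ = t ∧
    K.map d.op σ = K.map e.op y.2.1.1 ∧ stdSimplex.map e t₀ = y.2.2

variable {K : SSet.{u}}

lemma map_toFun_comp {a b c : SimplexCategory} (f : a ⟶ b) (g : b ⟶ c)
    (t : stdSimplex ℝ (Fin (a.len + 1))) :
    stdSimplex.map (f ≫ g) t = stdSimplex.map g (stdSimplex.map f t) := by
  rw [stdSimplex.map_comp_apply]
  rfl

lemma IsNormalForm.exists {n : SimplexCategory} (σ : K.obj (op n))
    (t : stdSimplex ℝ (Fin (n.len + 1))) : ∃ y, IsNormalForm σ t y := by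
  obtain ⟨k, d, t₀, hd, ht₀, h⟩ := stdSimplex.exists_eq_map_of_pos t
  let d' : ⦋k⦌ ⟶ n := SimplexCategory.Hom.mk ⟨d, hd.monotone⟩
  obtain ⟨m, e, he, τ, hτ⟩ := K.exists_nonDegenerate (K.map d'.op σ)
  exact ⟨⟨m, τ, stdSimplex.map e t₀⟩, k, d', e, t₀,
    SimplexCategory.mono_iff_injective.2 hd.injective, he, ht₀, h.symm, hτ, rfl⟩

/-- The face is determined by the support of `t`; the nondegenerate simplex and the collapsing map
are then determined by the Eilenberg–Zilber lemma. -/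
lemma IsNormalForm.unique {n : SimplexCategory} {σ : K.obj (op n)}
    {t : stdSimplex ℝ (Fin (n.len + 1))} {y y' : CellPoint K} (h : IsNormalForm σ t y)
    (h' : IsNormalForm σ t y') : y = y' := by
  obtain ⟨m, τ, u⟩ := y
  obtain ⟨m', τ', u'⟩ := y'
  obtain ⟨k, d, e, t₀, hd, he, ht₀, hdt, hσ, hu⟩ := h
  obtain ⟨k', d', e', t₀', hd', he', ht₀', hdt', hσ', hu'⟩ := h'
  have mono : ∀ {k : ℕ} (d : ⦋k⦌ ⟶ n), Mono d → StrictMono d := fun d hd =>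
    d.toOrderHom.monotone.strictMono_of_injective (SimplexCategory.mono_iff_injective.1 hd)
  obtain ⟨rfl, hdd, htt⟩ := stdSimplex.eq_of_map_eq_map (n := n.len) (k := k) (l := k') (mono d hd) (mono d' hd') ht₀ ht₀'
    (hdt.trans hdt'.symm)
  obtain rfl : d = d' := by
    ext i : 3
    exact congrFun hdd i
  obtain rfl : t₀ = t₀' := stdSimplex.ext (funext htt)
  obtain rfl := K.unique_nonDegenerate_dim _ e τ hσ e' τ' hσ'
  obtain rfl := K.unique_nonDegenerate_simplex _ e τ hσ e' τ' hσ'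
  obtain rfl := K.unique_nonDegenerate_map _ e τ hσ e' τ hσ'
  obtain rfl : u = u' := hu.symm.trans hu'
  rfl

/-- Factor `d ≫ f` into an epimorphism and a monomorphism. The monomorphism is the new face, the
epimorphism keeps all coordinates positive, and the Eilenberg–Zilber lemma shows that the
nondegenerate simplex has not changed. -/
lemma IsNormalForm.map {m n : SimplexCategory} (f : m ⟶ n) {σ : K.obj (op n)}
    {t : stdSimplex ℝ (Fin (m.len + 1))} {y : CellPoint K}
    (h : IsNormalForm (K.map f.op σ) t y) : IsNormalForm σ (stdSimplex.map f t) y := by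
  obtain ⟨l, τ, u⟩ := y
  obtain ⟨k, d, e, t₀, hd, he, ht₀, rfl, hσ, hu⟩ := h
  dsimp only at e hσ hu
  generalize hI : image (d ≫ f) = I
  obtain ⟨p, i, hp, hi, hpi⟩ : ∃ (p : ⦋k⦌ ⟶ ⦋I.len⦌) (i : ⦋I.len⦌ ⟶ n), Epi p ∧ Mono i ∧
      p ≫ i = d ≫ f := by
    subst hI
    exact ⟨factorThruImage (d ≫ f), image.ι (d ≫ f), inferInstance, inferInstance,
      image.fac (d ≫ f)⟩
  obtain ⟨l', e', he', τ', hτ'⟩ := K.exists_nonDegenerate (K.map i.op σ)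
  have h1 : K.map p.op (K.map i.op σ) = K.map e.op τ.1 := by
    rw [← hσ, ← comp_apply, ← comp_apply, ← K.map_comp, ← K.map_comp, ← op_comp, ← op_comp, hpi]
  have h2 : K.map p.op (K.map i.op σ) = K.map (p ≫ e').op τ'.1 := by
    rw [hτ', ← comp_apply, ← K.map_comp, ← op_comp]
  have := epi_comp p e'
  obtain rfl := K.unique_nonDegenerate_dim _ e τ h1 (p ≫ e') τ' h2
  obtain rfl := K.unique_nonDegenerate_simplex _ e τ h1 (p ≫ e') τ' h2
  obtain rfl := K.unique_nonDegenerate_map _ e τ h1 (p ≫ e') τ h2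
  refine ⟨_, i, e', stdSimplex.map p t₀, hi, he', fun j => ?_, ?_, hτ', ?_⟩
  · exact stdSimplex.map_apply_pos t₀ ht₀ (SimplexCategory.epi_iff_surjective.1 hp j)
  · rw [← map_toFun_comp, ← map_toFun_comp]
    exact congrArg (fun g : ⦋k⦌ ⟶ n => stdSimplex.map g t₀) hpi
  · exact (map_toFun_comp _ _ _).symm.trans hu

lemma IsNormalForm.cellMap_eq {n : SimplexCategory} {σ : K.obj (op n)}
    {t : stdSimplex ℝ (Fin (n.len + 1))} {y : CellPoint K} (h : IsNormalForm σ t y) :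
    cellMap (n := ⦋y.1⦌) y.2.1.1 y.2.2 = cellMap σ t := by
  obtain ⟨k, d, e, t₀, hd, he, ht₀, rfl, hσ, h⟩ := h
  rw [← h, ← cellMap_map d, hσ, cellMap_map e]

lemma isNormalForm_of_pos {n : ℕ} (σ : K.nonDegenerate n) {t : stdSimplex ℝ (Fin (n + 1))}
    (ht : ∀ i, 0 < t i) : IsNormalForm (n := ⦋n⦌) σ.1 t ⟨n, σ, t⟩ :=
  ⟨n, 𝟙 _, 𝟙 _, t, inferInstance, inferInstance, ht, stdSimplex.map_id_apply t, rfl,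
    stdSimplex.map_id_apply t⟩

lemma IsNormalForm.pos {n : SimplexCategory} {σ : K.obj (op n)}
    {t : stdSimplex ℝ (Fin (n.len + 1))} {y : CellPoint K} (h : IsNormalForm σ t y) (i) :
    0 < y.2.2 i := by
  obtain ⟨k, d, e, t₀, hd, he, ht₀, -, -, h⟩ := h
  rw [← h]
  exact stdSimplex.map_apply_pos t₀ ht₀ (SimplexCategory.epi_iff_surjective.1 he i)

/-- For the indiscrete topology on `CellPoint K` every function is continuous, so the universal
property also descends functions that are merely set-theoretic. -/
lemma exists_normalForm (K : SSet.{u}) : ∃ F : SSet.toTop.obj K → CellPoint K,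
    ∀ {n : SimplexCategory} (σ : K.obj (op n)) t, IsNormalForm σ t (F (cellMap σ t)) := by
  choose φ hφ using fun (n : SimplexCategory) (σ : K.obj (op n)) t => IsNormalForm.exists σ t
  obtain ⟨F, hF⟩ := exists_desc (K := K) (Y := @TopCat.of (CellPoint K) ⊤)
    (fun n σ => @ContinuousMap.mk _ _ _ ⊤ (φ n σ) continuous_top)
    (fun m n f σ t => (hφ _ _ _).map f |>.unique (hφ _ _ _))
  refine ⟨F, fun {n} σ t => ?_⟩
  rw [hF]
  exact hφ _ _ _

/-- Two maps to an indiscrete set of truth values, the constant `True` and the indicator of the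
union of all cells, agree on every cell and are therefore equal. -/
lemma cellMap_surjective (z : SSet.toTop.obj K) :
    ∃ (n : SimplexCategory) (σ : K.obj (op n)) (t : _), cellMap σ t = z := by
  let Y : TopCat.{u} := @TopCat.of (ULift Prop) ⊤
  let F : SSet.toTop.obj K ⟶ Y := @TopCat.ofHom _ _ _ ⊤
    (@ContinuousMap.mk _ _ _ ⊤ (fun _ => ULift.up True) continuous_top)
  let G : SSet.toTop.obj K ⟶ Y := @TopCat.ofHom _ _ _ ⊤
    (@ContinuousMap.mk _ _ _ ⊤ (fun z => ULift.up (∃ (n : SimplexCategory) (σ : K.obj (op n))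
      (t : _), cellMap σ t = z)) continuous_top)
  have h : F = G := toTop_hom_ext fun {n} σ t =>
    congrArg ULift.up (eq_true ⟨n, σ, t, rfl⟩).symm
  have : True = _ := congrArg ULift.down (ConcreteCategory.congr_hom h z)
  exact of_eq_true this.symm

/-- The normal form of a point of the realization. -/
noncomputable def nf (z : SSet.toTop.obj K) : CellPoint K := (exists_normalForm K).choose z

lemma isNormalForm_nf {n : SimplexCategory} (σ : K.obj (op n)) (t) :
    IsNormalForm σ t (nf (cellMap σ t)) := (exists_normalForm K).choose_spec σ t

lemma cellMap_nf (z : SSet.toTop.obj K) :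
    cellMap (n := ⦋(nf z).1⦌) (nf z).2.1.1 (nf z).2.2 = z := by
  obtain ⟨n, σ, t, rfl⟩ := cellMap_surjective z
  exact (isNormalForm_nf σ t).cellMap_eq

lemma nf_pos (z : SSet.toTop.obj K) (i) : 0 < (nf z).2.2 i := by
  obtain ⟨n, σ, t, rfl⟩ := cellMap_surjective z
  exact (isNormalForm_nf σ t).pos i

lemma nf_cellMap_of_pos {n : ℕ} (σ : K.nonDegenerate n) {t : stdSimplex ℝ (Fin (n + 1))}
    (ht : ∀ i, 0 < t i) : nf (cellMap (n := ⦋n⦌) σ.1 t) = ⟨n, σ, t⟩ :=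
  (isNormalForm_nf (n := ⦋n⦌) σ.1 t).unique (isNormalForm_of_pos σ ht)

lemma nf_fst_lt_of_eq_zero {n : ℕ} (σ : K _⦋n⦌) {t : stdSimplex ℝ (Fin (n + 1))} {i}
    (ht : t i = 0) : (nf (cellMap (n := ⦋n⦌) σ t)).1 < n := by
  obtain ⟨k, d, e, t₀, hd, he, ht₀, hdt, -, -⟩ := isNormalForm_nf (n := ⦋n⦌) σ t
  have h1 := SimplexCategory.len_le_of_epi e
  have h2 := SimplexCategory.len_le_of_mono d
  have h3 : k ≠ n := by
    rintro rfl
    have hs : Function.Surjective d :=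
      Finite.surjective_of_injective (SimplexCategory.mono_iff_injective.1 hd)
    have := stdSimplex.map_apply_pos (f := d) t₀ ht₀ (hs i)
    rw [hdt, ht] at this
    exact lt_irrefl _ this
  simp only [SimplexCategory.len_mk] at h1 h2
  omega

/-- A compatible family of functions on the simplices descends to the realization. -/
lemma cellMap_nf_desc {Y : Type*}
    (φ : ∀ ⦃n : SimplexCategory⦄, K.obj (op n) → stdSimplex ℝ (Fin (n.len + 1)) → Y)
    (hφ : ∀ ⦃m n : SimplexCategory⦄ (f : m ⟶ n) (σ : K.obj (op n)) t,
      φ (K.map f.op σ) t = φ σ (stdSimplex.map f t)) {n : SimplexCategory} (σ : K.obj (op n)) (t) :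
    φ (n := ⦋(nf (cellMap σ t)).1⦌) (nf (cellMap σ t)).2.1.1 (nf (cellMap σ t)).2.2 = φ σ t := by
  obtain ⟨k, d, e, t₀, hd, he, ht₀, hdt, hσ, h⟩ := isNormalForm_nf σ t
  rw [← h, ← hφ e, ← hσ, hφ d, hdt]

/-! ### The topology of the realization -/

lemma isClosed_iff_forall {A : Set (SSet.toTop.obj K)} :
    IsClosed A ↔ ∀ (n : SimplexCategory) (σ : K.obj (op n)), IsClosed (cellMap σ ⁻¹' A) := by
  refine ⟨fun h n σ => h.preimage (cellMap σ).continuous, fun h => ?_⟩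
  -- The same set with the finest topology that makes all cells continuous. By the universal
  -- property the identity into it is continuous, so whatever is closed for this topology is closed.
  let Y : TopCat.{u} := @TopCat.of (SSet.toTop.obj K)
    (⨆ (n : SimplexCategory) (σ : K.obj (op n)), .coinduced (cellMap σ) inferInstance)
  have hY : ∀ {n : SimplexCategory} (σ : K.obj (op n)),
      Continuous (Y := Y) fun t => (cellMap σ t : SSet.toTop.obj K) := fun {n} σ =>
    continuous_iff_coinduced_le.2 (le_iSup₂_of_le n σ le_rfl)
  obtain ⟨F, hF⟩ := exists_desc (K := K) (Y := Y) (fun n σ => ⟨_, hY σ⟩)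
    (fun m n f σ t => cellMap_map f σ t)
  have hF' : ∀ z, F z = z := fun z => by
    obtain ⟨n, σ, t, rfl⟩ := cellMap_surjective z
    exact hF σ t
  have hA : IsClosed (X := Y) A :=
    isClosed_iSup_iff.2 fun n => isClosed_iSup_iff.2 fun σ => isClosed_coinduced.2 (h n σ)
  have := hA.preimage F.hom.continuous
  convert this using 1
  ext z
  exact iff_of_eq (congrArg (· ∈ A) (hF' z).symm)

lemma isClosed_iff {A : Set (SSet.toTop.obj K)} :
    IsClosed A ↔ ∀ (n : ℕ) (σ : K.nonDegenerate n), IsClosed (cellMap (n := ⦋n⦌) σ.1 ⁻¹' A) := by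
  refine ⟨fun h n σ => h.preimage (cellMap _).continuous, fun h => ?_⟩
  refine isClosed_iff_forall.2 fun n σ => ?_
  obtain ⟨m, e, he, τ, hτ⟩ := K.exists_nonDegenerate (n := n.len) σ
  have : cellMap σ ⁻¹' A = stdSimplex.map e ⁻¹' (cellMap (n := ⦋m⦌) τ.1 ⁻¹' A) := by
    ext t
    simp only [Set.mem_preimage]
    rw [← cellMap_map e]
    have hτ' : σ = K.map e.op τ.1 := hτ
    rw [hτ']
  rw [this]
  exact (h m τ).preimage (stdSimplex.continuous_map _)

lemma continuous_of_comp_cellMap {Y : Type*} [TopologicalSpace Y] {F : SSet.toTop.obj K → Y}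
    (h : ∀ (n : ℕ) (σ : K.nonDegenerate n), Continuous fun t => F (cellMap (n := ⦋n⦌) σ.1 t)) :
    Continuous F :=
  continuous_iff_isClosed.2 fun _ hA => isClosed_iff.2 fun n σ => hA.preimage (h n σ)

end Realization

namespace Realization

variable {K : SSet.{u}}

lemma nf_fst_cellMap_le {n : SimplexCategory} (σ : K.obj (op n)) (t) :
    (nf (cellMap σ t)).1 ≤ n.len := by
  obtain ⟨k, d, e, t₀, hd, he, ht₀, hdt, -, -⟩ := isNormalForm_nf σ t
  exact (SimplexCategory.len_le_of_epi e).trans (SimplexCategory.len_le_of_mono d)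

lemma pos_or_exists_eq_zero {n : ℕ} (t : stdSimplex ℝ (Fin (n + 1))) :
    (∀ i, 0 < t i) ∨ ∃ i, t i = 0 := by
  by_contra! h
  obtain ⟨⟨i, hi⟩, h2⟩ := h
  exact h2 i (le_antisymm hi (stdSimplex.zero_le t i))

/-- A subset of a skeleton is closed as soon as its preimages in the simplices of this skeleton
are closed. -/
lemma isClosed_of_nf_fst_le {A : Set (SSet.toTop.obj K)} (N : ℕ)
    (hA : ∀ z ∈ A, (nf z).1 ≤ N)
    (h : ∀ n ≤ N, ∀ σ : K.nonDegenerate n, IsClosed (cellMap (n := ⦋n⦌) σ.1 ⁻¹' A)) :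
    IsClosed A := by
  refine isClosed_iff.2 fun n => ?_
  induction n using Nat.strong_induction_on with | _ n ih
  intro σ
  by_cases hn : n ≤ N
  · exact h n hn σ
  have key : ∀ k < n, ∀ τ : K.obj (op ⦋k⦌), IsClosed (cellMap τ ⁻¹' A) := fun k hk τ => by
    obtain ⟨m, e, he, τ', hτ'⟩ := K.exists_nonDegenerate τ
    have hm : m ≤ k := SimplexCategory.len_le_of_epi e
    have := (ih m (hm.trans_lt hk) τ').preimage (stdSimplex.continuous_map (S := ℝ) e)
    convert this using 1
    ext t
    rw [hτ', Set.mem_preimage, cellMap_map e]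
    rfl
  -- Interior points of a nondegenerate cell of dimension n > N lie outside `A`. The preimage thus
  -- lives on the finitely many proper faces, where the induction hypothesis applies.
  have hU : cellMap (n := ⦋n⦌) σ.1 ⁻¹' A = ⋃ (k : Fin n), ⋃ d : ⦋k.1⦌ ⟶ ⦋n⦌,
      stdSimplex.map d '' (cellMap (K.map d.op σ.1) ⁻¹' A) := by
    ext t
    simp only [Set.mem_preimage, Set.mem_iUnion, Set.mem_image]
    constructor
    · intro ht
      obtain ⟨k, d, t₀, hd, ht₀, rfl⟩ := stdSimplex.exists_eq_map_of_pos t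
      have hkn : k ≤ n := by
        have := Fintype.card_le_of_injective d hd.injective
        simpa using this
      obtain rfl | hkn := hkn.eq_or_lt
      · exfalso
        have hs : Function.Surjective d := Finite.surjective_of_injective hd.injective
        have := nf_cellMap_of_pos σ (t := stdSimplex.map d t₀) fun j =>
          stdSimplex.map_apply_pos t₀ ht₀ (hs j)
        have h2 := hA _ ht
        rw [this] at h2
        exact hn h2
      · refine ⟨⟨k, hkn⟩, SimplexCategory.Hom.mk ⟨d, hd.monotone⟩, t₀, ?_, rfl⟩
        rw [cellMap_map]
        exact ht
    · rintro ⟨k, d, t₀, h, rfl⟩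
      rwa [cellMap_map] at h
  rw [hU]
  have (k : Fin n) : Finite (⦋k.1⦌ ⟶ ⦋n⦌) :=
    Finite.of_injective (fun f => (f : Fin (k.1 + 1) → Fin (n + 1))) fun f g h => by
      ext i : 3; exact congrFun h i
  refine isClosed_iUnion_of_finite fun k => isClosed_iUnion_of_finite fun d => ?_
  exact (stdSimplex.continuous_map (S := ℝ) d).isClosedMap _ (key _ k.2 _)

lemma isClosed_singleton' (z : SSet.toTop.obj K) : IsClosed ({z} : Set (SSet.toTop.obj K)) := by
  refine isClosed_of_nf_fst_le (nf z).1 (by rintro _ rfl; exact le_rfl) fun n hn σ => ?_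
  apply Set.Subsingleton.isClosed
  have key : ∀ t, cellMap (n := ⦋n⦌) σ.1 t = z → nf z = ⟨n, σ, t⟩ := by
    rintro t rfl
    obtain ht | ⟨i, hi⟩ := pos_or_exists_eq_zero t
    · exact nf_cellMap_of_pos σ ht
    · exact absurd (nf_fst_lt_of_eq_zero σ.1 hi) (not_lt.2 hn)
  intro t ht t' ht'
  have := (key t ht).symm.trans (key t' ht')
  simpa using this

/-- A simplex of dimension n maps into the n-skeleton, where `A` is a finite set of closed points.
-/
lemma isClosed_of_finite {A : Set (SSet.toTop.obj K)}
    (hA : ∀ N, {z | z ∈ A ∧ (nf z).1 ≤ N}.Finite) : IsClosed A := by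
  refine isClosed_iff.2 fun n σ => ?_
  have h1 : IsClosed {z | z ∈ A ∧ (nf z).1 ≤ n} := by
    rw [← Set.biUnion_of_singleton {z | z ∈ A ∧ (nf z).1 ≤ n}]
    exact (hA n).isClosed_biUnion fun z _ => isClosed_singleton' z
  convert h1.preimage (cellMap (n := ⦋n⦌) σ.1).continuous using 1
  ext t
  exact ⟨fun h => ⟨h, nf_fst_cellMap_le _ _⟩, fun h => h.1⟩

/-- A compact subset of the realization is contained in a skeleton. -/
lemma exists_nf_fst_le {T : Type*} [TopologicalSpace T] [CompactSpace T]
    (γ : C(T, SSet.toTop.obj K)) : ∃ N, ∀ t, (nf (γ t)).1 ≤ N := by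
  by_contra! h
  choose τ hτ using h
  -- The tails of a sequence that leaves every skeleton. They are closed, so compactness of `T`
  -- gives a common point; lying in the tail indexed by its own dimension, it would have a dimension
  -- larger than that.
  let A : ℕ → Set (SSet.toTop.obj K) := fun m => (fun k => γ (τ k)) '' Set.Ici m
  have hA : ∀ m, IsClosed (A m) := fun m => isClosed_of_finite fun N => by
    refine ((Set.finite_Iio N).image fun k => γ (τ k)).subset ?_
    rintro _ ⟨⟨k, -, rfl⟩, hk⟩
    exact ⟨k, (hτ k).trans_le hk, rfl⟩
  obtain ⟨t, ht⟩ := IsCompact.nonempty_iInter_of_sequence_nonempty_isCompact_isClosed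
    (fun m => γ ⁻¹' A m)
    (fun m => Set.preimage_mono (Set.image_mono (Set.Ici_subset_Ici.2 m.le_succ)))
    (fun m => ⟨τ m, m, Set.self_mem_Ici, rfl⟩)
    (((hA 0).preimage γ.continuous).isCompact)
    (fun m => (hA m).preimage γ.continuous)
  obtain ⟨k, hk, hk'⟩ := Set.mem_iInter.1 ht ((nf (γ t)).1)
  have := hτ k
  dsimp only at hk'
  rw [hk'] at this
  exact absurd this (not_lt.2 hk)

/-- Within the n-skeleton this is the complement of the image of the interior points outside `A`.
For `A = ∅` it says that an open cell is open in its skeleton; for general `A` it yields continuity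
of the lift to the simplex of a path in an open cell. -/
lemma isClosed_cellSet {n : ℕ} (σ : K.nonDegenerate n) {A : Set (stdSimplex ℝ (Fin (n + 1)))}
    (hA : IsClosed A) : IsClosed {z | (nf z).1 ≤ n ∧
      ∀ t, (∀ i, 0 < t i) → cellMap (n := ⦋n⦌) σ.1 t = z → t ∈ A} := by
  refine isClosed_of_nf_fst_le n (fun z hz => hz.1) fun m hm τ => ?_
  by_cases hτ : (⟨m, τ⟩ : Σ m, K.nonDegenerate m) = ⟨n, σ⟩
  · cases hτ
    have : IsClosed (A ∪ ⋃ i, {t | t i = 0}) :=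
      hA.union (isClosed_iUnion_of_finite fun i => isClosed_eq
        ((continuous_apply i).comp continuous_subtype_val) continuous_const)
    convert this using 1
    ext t
    simp only [Set.mem_preimage, Set.mem_union, Set.mem_iUnion, Set.mem_ofPred_eq]
    constructor
    · rintro ⟨-, h⟩
      exact (pos_or_exists_eq_zero t).imp_left fun ht => h t ht rfl
    · intro h
      refine ⟨nf_fst_cellMap_le _ _, fun t' ht' htt' => ?_⟩
      have h1 := nf_cellMap_of_pos σ ht'
      rw [htt'] at h1
      obtain h | ⟨i, hi⟩ := h
      · obtain ht | ⟨i, hi⟩ := pos_or_exists_eq_zero t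
        · rw [nf_cellMap_of_pos σ ht] at h1
          obtain rfl : t = t' := by simpa using h1
          exact h
        · have := nf_fst_lt_of_eq_zero σ.1 hi
          rw [h1] at this
          exact absurd this (lt_irrefl _)
      · have := nf_fst_lt_of_eq_zero σ.1 hi
        rw [h1] at this
        exact absurd this (lt_irrefl _)
  · convert isClosed_univ using 1
    refine Set.eq_univ_of_forall fun t => ⟨(nf_fst_cellMap_le _ _).trans hm, fun t' ht' h => ?_⟩
    exfalso
    have h1 := nf_cellMap_of_pos σ ht'
    rw [h] at h1
    obtain ht | ⟨i, hi⟩ := pos_or_exists_eq_zero t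
    · rw [nf_cellMap_of_pos τ ht] at h1
      apply hτ
      exact congrArg (fun y : CellPoint K => (⟨y.1, y.2.1⟩ : Σ m, K.nonDegenerate m)) h1
    · have := nf_fst_lt_of_eq_zero τ.1 hi
      rw [h1] at this
      exact absurd hm (not_le.2 this)

end Realization

/-! ### Radial expansion of a simplex -/

section

open unitInterval

namespace stdSimplex

variable {n : ℕ}

/-- The minimal barycentric coordinate, normalized to have value `1` at the barycenter. -/
noncomputable def depth (t : stdSimplex ℝ (Fin (n + 1))) : ℝ :=
  (n + 1) * Finset.univ.inf' Finset.univ_nonempty (fun i => t i)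

lemma continuous_apply' (i : Fin (n + 1)) :
    Continuous fun t : stdSimplex ℝ (Fin (n + 1)) => t i :=
  (continuous_apply i).comp continuous_subtype_val

lemma continuous_depth : Continuous (depth (n := n)) :=
  continuous_const.mul (Continuous.finset_inf'_apply _ fun i _ => continuous_apply' i)

lemma depth_le (t : stdSimplex ℝ (Fin (n + 1))) (i) : depth t ≤ (n + 1) * t i := by
  unfold depth
  gcongr
  exact Finset.inf'_le _ (Finset.mem_univ i)

lemma exists_depth_eq (t : stdSimplex ℝ (Fin (n + 1))) : ∃ i, depth t = (n + 1) * t i := by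
  obtain ⟨i, -, hi⟩ := Finset.exists_mem_eq_inf' Finset.univ_nonempty (fun i => t i)
  exact ⟨i, by rw [depth, hi]⟩

lemma depth_nonneg (t : stdSimplex ℝ (Fin (n + 1))) : 0 ≤ depth t := by
  obtain ⟨i, hi⟩ := exists_depth_eq t
  rw [hi]
  have := zero_le t i
  positivity

/-- The factor by which the radial expansion stretches. -/
noncomputable def stretch (t : stdSimplex ℝ (Fin (n + 1))) : ℝ := (max (1 - depth t) (1 / 2))⁻¹

lemma continuous_stretch : Continuous (stretch (n := n)) :=
  ((continuous_const.sub continuous_depth).max continuous_const).inv₀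
    fun _ => (lt_max_of_lt_right one_half_pos).ne'

lemma one_le_stretch (t : stdSimplex ℝ (Fin (n + 1))) : 1 ≤ stretch t := by
  refine (one_le_inv₀ (lt_max_of_lt_right one_half_pos)).2 (max_le ?_ (by norm_num))
  linarith [depth_nonneg t]

lemma stretch_mul_le (t : stdSimplex ℝ (Fin (n + 1))) : stretch t * (1 - depth t) ≤ 1 := by
  unfold stretch
  have : (0 : ℝ) < max (1 - depth t) (1 / 2) := lt_max_of_lt_right one_half_pos
  rw [inv_mul_le_iff₀ this, mul_one]
  exact le_max_left _ _

/-- The radial expansion of a simplex away from its barycenter. -/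
noncomputable def radial (x : I × stdSimplex ℝ (Fin (n + 1))) : stdSimplex ℝ (Fin (n + 1)) :=
  ⟨fun i => x.2 i + x.1 * (stretch x.2 - 1) * (x.2 i - 1 / (n + 1)), fun i => by
    have h1 := one_le_stretch x.2
    have h2 := stretch_mul_le x.2
    have h3 := depth_le x.2 i
    have h4 := x.1.2.1
    have h5 := x.1.2.2
    have h6 := zero_le x.2 i
    have hn : (0 : ℝ) < n + 1 := by positivity
    change 0 ≤ x.2 i + x.1 * (stretch x.2 - 1) * (x.2 i - 1 / (n + 1))
    generalize x.2 i = a at *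
    generalize stretch x.2 = l at *
    generalize depth x.2 = m at *
    generalize (x.1 : ℝ) = s at *
    -- Nonnegativity at time 1, from `stretch * (1 - depth) ≤ 1`. At time s the coordinate is a
    -- convex combination of those at times 0 and 1.
    have h7 : 0 ≤ (n + 1) * (a + (l - 1) * (a - 1 / (n + 1))) := by
      have : (n + 1) * (a + (l - 1) * (a - 1 / (n + 1))) = l * ((n + 1) * a) - (l - 1) := by
        field_simp
        ring
      rw [this]
      nlinarith
    have h8 := nonneg_of_mul_nonneg_right h7 hn
    nlinarith [mul_nonneg h4 h8, mul_nonneg (sub_nonneg.2 h5) h6], by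
    have hn : (n : ℝ) + 1 ≠ 0 := by positivity
    rw [Finset.sum_add_distrib, ← Finset.mul_sum, Finset.sum_sub_distrib, sum_eq_one]
    simp [hn]⟩

lemma radial_apply (s : I) (t : stdSimplex ℝ (Fin (n + 1))) (i) :
    radial (s, t) i = t i + s * (stretch t - 1) * (t i - 1 / (n + 1)) := rfl

lemma continuous_radial : Continuous (radial (n := n)) := by
  refine Continuous.subtype_mk (continuous_pi fun i => ?_) _
  have h1 := (continuous_apply' (n := n) i).comp (continuous_snd (X := I))
  have h2 := (continuous_stretch (n := n)).comp (continuous_snd (X := I))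
  exact h1.add (((continuous_subtype_val.comp continuous_fst).mul (h2.sub continuous_const)).mul
    (h1.sub continuous_const))

@[simp]
lemma radial_zero (t : stdSimplex ℝ (Fin (n + 1))) : radial (0, t) = t := by
  ext i
  simp [radial_apply]

lemma radial_of_eq_zero (s : I) {t : stdSimplex ℝ (Fin (n + 1))} {i} (hi : t i = 0) :
    radial (s, t) = t := by
  have hd : depth t = 0 :=
    le_antisymm (by simpa [hi] using depth_le t i) (depth_nonneg t)
  have hs : stretch t = 1 := by
    rw [stretch, hd]
    norm_num
  ext j
  simp [radial_apply, hs]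

/-- The smallest coordinate falls short of `1 / (n + 1)` by `(1 - depth t) / (n + 1)`, and
stretching by `(1 - depth t)⁻¹` turns this deficit into `1 / (n + 1)`. The cut-off at `1 / 2` in
`stretch` keeps the factor bounded near the barycenter and is inactive here. -/
lemma exists_radial_one_eq_zero {t : stdSimplex ℝ (Fin (n + 1))} (ht : depth t < 1 / 2) :
    ∃ i, radial (1, t) i = 0 := by
  obtain ⟨i, hi⟩ := exists_depth_eq t
  refine ⟨i, ?_⟩
  have hs : stretch t = (1 - depth t)⁻¹ := by
    rw [stretch, max_eq_left (by linarith)]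
  have h1 : 1 - depth t ≠ 0 := by linarith
  have hn : (n : ℝ) + 1 ≠ 0 := by positivity
  have h2 : t i = depth t / (n + 1) := by
    rw [hi]
    field_simp
  rw [radial_apply, hs, h2]
  simp only [Set.Icc.coe_one]
  field_simp
  ring

lemma depth_of_eq_zero {t : stdSimplex ℝ (Fin (n + 1))} {i} (hi : t i = 0) : depth t = 0 :=
  le_antisymm (by simpa [hi] using depth_le t i) (depth_nonneg t)

end stdSimplex

/-- The two ways around a square are homotopic. -/
lemma mk_square {X : Type*} [TopologicalSpace X] (F : C(I × I, X)) {x₀ x₁ y₀ y₁ : X}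
    (p : Path x₀ x₁) (q : Path x₁ y₁) (p' : Path y₀ y₁) (q' : Path x₀ y₀)
    (hp : ∀ τ, p τ = F (0, τ)) (hq : ∀ s, q s = F (s, 1)) (hp' : ∀ τ, p' τ = F (1, τ))
    (hq' : ∀ s, q' s = F (s, 0)) :
    (Path.Homotopic.Quotient.mk p).trans (.mk q) =
      (Path.Homotopic.Quotient.mk q').trans (.mk p') := by
  obtain rfl : x₀ = F (0, 0) := by rw [← hp, p.source]
  obtain rfl : x₁ = F (0, 1) := by rw [← hp, p.target]
  obtain rfl : y₀ = F (1, 0) := by rw [← hp', p'.source]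
  obtain rfl : y₁ = F (1, 1) := by rw [← hp', p'.target]
  let a : Path ((0, 0) : I × I) (0, 1) := ⟨⟨fun s => (0, s), by fun_prop⟩, rfl, rfl⟩
  let b : Path ((0, 1) : I × I) (1, 1) := ⟨⟨fun s => (s, 1), by fun_prop⟩, rfl, rfl⟩
  let c : Path ((0, 0) : I × I) (1, 0) := ⟨⟨fun s => (s, 0), by fun_prop⟩, rfl, rfl⟩
  let d : Path ((1, 0) : I × I) (1, 1) := ⟨⟨fun s => (1, s), by fun_prop⟩, rfl, rfl⟩
  obtain rfl : p = a.map F.continuous := Path.ext (funext hp)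
  obtain rfl : q = b.map F.continuous := Path.ext (funext hq)
  obtain rfl : p' = d.map F.continuous := Path.ext (funext hp')
  obtain rfl : q' = c.map F.continuous := Path.ext (funext hq')
  have : SimplyConnectedSpace (I × I) := by
    have : ContractibleSpace I := (convex_Icc (0 : ℝ) 1).contractibleSpace ⟨0, by simp⟩
    infer_instance
  have h := (SimplyConnectedSpace.paths_homotopic (a.trans b) (c.trans d)).map F
  rw [Path.map_trans, Path.map_trans] at h
  exact Path.Homotopic.Quotient.eq.2 h

end

/-! ### Decomposition of paths into paths inside simplices -/

section

open unitInterval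

namespace Realization

variable {K : SSet.{u}}

/-- The track of a point under the radial expansion of the `n`-dimensional cells. -/
noncomputable def cellTrack (n : ℕ) (y : CellPoint K) : C(I, SSet.toTop.obj K) :=
  if y.1 = n then
    (cellMap (n := ⦋y.1⦌) y.2.1.1).comp ⟨fun s => stdSimplex.radial (s, y.2.2),
      stdSimplex.continuous_radial.comp (by fun_prop)⟩
  else .const _ (cellMap (n := ⦋y.1⦌) y.2.1.1 y.2.2)

/-- The track of a point of the realization under the radial expansion of the `n`-dimensional
cells. -/
noncomputable def track (n : ℕ) (z : SSet.toTop.obj K) : C(I, SSet.toTop.obj K) :=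
  cellTrack n (nf z)

/-- The two clauses of `cellTrack` fit together because the expansion fixes the boundary of the
simplex, whose points have normal forms of lower dimension. -/
lemma track_cellMap {n : ℕ} (ρ : K.nonDegenerate n) (t : stdSimplex ℝ (Fin (n + 1))) (s : I) :
    track n (cellMap (n := ⦋n⦌) ρ.1 t) s = cellMap (n := ⦋n⦌) ρ.1 (stdSimplex.radial (s, t)) := by
  obtain ht | ⟨i, hi⟩ := pos_or_exists_eq_zero t
  · rw [track, nf_cellMap_of_pos ρ ht, cellTrack, if_pos rfl]
    rfl
  · rw [track, cellTrack, if_neg (nf_fst_lt_of_eq_zero ρ.1 hi).ne, ContinuousMap.const_apply,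
      cellMap_nf, stdSimplex.radial_of_eq_zero s hi]

lemma track_of_ne {n : ℕ} {z : SSet.toTop.obj K} (h : (nf z).1 ≠ n) (s : I) : track n z s = z := by
  rw [track, cellTrack, if_neg h, ContinuousMap.const_apply, cellMap_nf]

lemma exists_cellMap_of_nf_fst_eq {n : ℕ} {z : SSet.toTop.obj K} (h : (nf z).1 = n) :
    ∃ (ρ : K.nonDegenerate n) (t : stdSimplex ℝ (Fin (n + 1))),
      (∀ i, 0 < t i) ∧ cellMap (n := ⦋n⦌) ρ.1 t = z := by
  subst h
  exact ⟨(nf z).2.1, (nf z).2.2, nf_pos z, cellMap_nf z⟩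

lemma track_zero (n : ℕ) (z : SSet.toTop.obj K) : track n z 0 = z := by
  by_cases h : (nf z).1 = n
  · obtain ⟨ρ, t, ht, rfl⟩ := exists_cellMap_of_nf_fst_eq h
    rw [track_cellMap, stdSimplex.radial_zero]
  · exact track_of_ne h 0

/-- Continuity of `track n` on the n-skeleton. The time variable is curried into the mapping space
so that closedness can be tested on cells; no statement about the product of the interval with the
realization is needed. -/
lemma isClosed_track {n : ℕ} {A : Set C(I, SSet.toTop.obj K)} (hA : IsClosed A) :
    IsClosed {z | (nf z).1 ≤ n ∧ track n z ∈ A} := by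
  refine isClosed_of_nf_fst_le n (fun z hz => hz.1) fun m hm τ => ?_
  obtain rfl | hmn := hm.eq_or_lt
  · have hc : Continuous fun t => track m (cellMap (n := ⦋m⦌) τ.1 t) := by
      refine ContinuousMap.continuous_of_continuous_uncurry _ ?_
      have : (Function.uncurry fun (t : stdSimplex ℝ (Fin (m + 1))) (s : I) =>
          track m (cellMap (n := ⦋m⦌) τ.1 t) s) =
          fun x => cellMap (n := ⦋m⦌) τ.1 (stdSimplex.radial (x.2, x.1)) := by
        ext ⟨t, s⟩
        exact track_cellMap τ t s
      exact this ▸ (cellMap _).continuous.comp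
        (stdSimplex.continuous_radial.comp (by fun_prop))
    convert hA.preimage hc using 1
    ext t
    exact ⟨fun h => h.2, fun h => ⟨nf_fst_cellMap_le _ _, h⟩⟩
  · have hc : Continuous fun t => ContinuousMap.const I (cellMap (n := ⦋m⦌) τ.1 t) :=
      ContinuousMap.continuous_const'.comp (cellMap _).continuous
    convert hA.preimage hc using 1
    ext t
    have h1 : (nf (cellMap (n := ⦋m⦌) τ.1 t)).1 ≤ m := nf_fst_cellMap_le _ _
    have h2 : track n (cellMap (n := ⦋m⦌) τ.1 t) = ContinuousMap.const I (cellMap _ t) :=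
      ContinuousMap.ext fun s => track_of_ne (h1.trans_lt hmn).ne s
    simp only [Set.mem_preimage, Set.mem_ofPred_eq]
    rw [h2]
    exact ⟨fun h => h.2, fun h => ⟨h1.trans hm, h⟩⟩

/-- Points of positive depth are interior and hence determined by their normal forms. An n-simplex
thus meets this set only in its own core, and simplices of lower dimension miss it, however many
cells there are. -/
lemma isClosed_depth (n : ℕ) : IsClosed {z | ∃ (ρ : K.nonDegenerate n)
    (t : stdSimplex ℝ (Fin (n + 1))), 1 / 2 ≤ stdSimplex.depth t ∧ cellMap (n := ⦋n⦌) ρ.1 t = z} := by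
  have hpos : ∀ t : stdSimplex ℝ (Fin (n + 1)), 1 / 2 ≤ stdSimplex.depth t → ∀ i, 0 < t i := fun t ht => by
    refine (pos_or_exists_eq_zero t).resolve_right ?_
    rintro ⟨i, hi⟩
    rw [stdSimplex.depth_of_eq_zero hi] at ht
    norm_num at ht
  have hlt : ∀ (m : ℕ) (τ : K.nonDegenerate m) (t' : stdSimplex ℝ (Fin (m + 1))), m ≤ n →
      ∀ (ρ : K.nonDegenerate n) (t : stdSimplex ℝ (Fin (n + 1))), 1 / 2 ≤ stdSimplex.depth t →
      cellMap (n := ⦋n⦌) ρ.1 t = cellMap (n := ⦋m⦌) τ.1 t' →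
      (⟨n, ρ, t⟩ : CellPoint K) = ⟨m, τ, t'⟩ := fun m τ t' hm ρ t ht h => by
    have h1 := nf_cellMap_of_pos ρ (hpos t ht)
    rw [h] at h1
    obtain ht' | ⟨i, hi⟩ := pos_or_exists_eq_zero t'
    · exact h1.symm.trans (nf_cellMap_of_pos τ ht')
    · have := nf_fst_lt_of_eq_zero τ.1 hi
      rw [h1] at this
      exact absurd this (not_lt.2 hm)
  refine isClosed_of_nf_fst_le n ?_ fun m hm τ => ?_
  · rintro _ ⟨ρ, t, -, rfl⟩
    exact nf_fst_cellMap_le _ _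
  · obtain rfl | hmn := hm.eq_or_lt
    · convert isClosed_le continuous_const (stdSimplex.continuous_depth (n := m)) using 1
      ext t'
      constructor
      · rintro ⟨ρ, t, ht, h⟩
        obtain ⟨rfl, rfl⟩ : ρ = τ ∧ t = t' := by simpa using hlt _ _ _ hm _ _ ht h
        exact ht
      · exact fun ht => ⟨τ, t', ht, rfl⟩
    · convert isClosed_empty using 1
      refine Set.eq_empty_of_forall_notMem ?_
      rintro t' ⟨ρ, t, ht, h⟩
      exact hmn.ne' (congrArg Sigma.fst (hlt _ _ _ hm _ _ ht h))

/-- A property of homotopy classes of paths in the realization of a simplicial set which is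
stable under composition and inversion and which holds for the paths in the simplices
holds for all paths. -/
theorem path_induction {G : ∀ {x y : SSet.toTop.obj K}, Path.Homotopic.Quotient x y → Prop}
    (trans : ∀ {x y z} (p : Path.Homotopic.Quotient x y) (q : Path.Homotopic.Quotient y z),
      G p → G q → G (p.trans q))
    (symm : ∀ {x y} (p : Path.Homotopic.Quotient x y), G p → G p.symm)
    (cell : ∀ {x y} (p : Path x y) (n : ℕ) (ρ : K.nonDegenerate n)
      (q : C(I, stdSimplex ℝ (Fin (n + 1)))), (∀ s, p s = cellMap (n := ⦋n⦌) ρ.1 (q s)) →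
      G (.mk p))
    {x y : SSet.toTop.obj K} (p : Path.Homotopic.Quotient x y) : G p := by
  have hrefl : ∀ x, G (.mk (Path.refl x)) := fun x =>
    cell _ _ (nf x).2.1 (.const _ (nf x).2.2) fun s => (cellMap_nf x).symm
  have hcast : ∀ {x y x' y' : SSet.toTop.obj K} (p : Path x y) (hx : x' = x) (hy : y' = y),
      G (.mk (p.cast hx hy)) → G (.mk p) := by
    rintro x y _ _ p rfl rfl h
    exact h
  -- Induction over skeleta; the strict inequality makes the case `N = 0` vacuous.
  suffices h : ∀ (N : ℕ) {x y : SSet.toTop.obj K} (p : Path x y),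
      (∀ s, (nf (p s)).1 < N) → G (.mk p) by
    induction p using Path.Homotopic.Quotient.ind with | mk p =>
    obtain ⟨N, hN⟩ := exists_nf_fst_le p.toContinuousMap
    exact h (N + 1) p fun s => Nat.lt_succ_of_le (hN s)
  intro n
  induction n with
  | zero => exact fun p h => absurd (h 0) (Nat.not_lt_zero _)
  | succ n ih =>
  intro x y p hp
  have hp' : ∀ s, (nf (p s)).1 ≤ n := fun s => Nat.le_of_lt_succ (hp s)
  -- the paths in an open cell
  have hB : ∀ {x y : SSet.toTop.obj K} (p : Path x y) (ρ : K.nonDegenerate n),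
      (∀ s, ∃ t : stdSimplex ℝ (Fin (n + 1)), (∀ i, 0 < t i) ∧
        cellMap (n := ⦋n⦌) ρ.1 t = p s) → G (.mk p) := by
    intro x y p ρ h
    choose q hq hqp using h
    refine cell p n ρ ⟨q, continuous_iff_isClosed.2 fun A hA => ?_⟩ fun s => (hqp s).symm
    convert (isClosed_cellSet ρ hA).preimage p.continuous using 1
    ext s
    constructor
    · intro hs
      refine ⟨hqp s ▸ nf_fst_cellMap_le _ _, fun t ht hts => ?_⟩
      have h1 := nf_cellMap_of_pos ρ ht
      rw [hts, ← hqp s, nf_cellMap_of_pos ρ (hq s)] at h1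
      obtain rfl : q s = t := by simpa using h1
      exact hs
    · exact fun hs => hs.2 _ (hq s) (hqp s)
  have htrack : ∀ (z : SSet.toTop.obj K) {x y : SSet.toTop.obj K} (p : Path x y),
      (∀ s, p s = track n z s) → G (.mk p) := by
    intro z x y p h
    by_cases hz : (nf z).1 = n
    · obtain ⟨ρ, t, ht, rfl⟩ := exists_cellMap_of_nf_fst_eq hz
      exact cell p n ρ ⟨fun s => stdSimplex.radial (s, t),
        stdSimplex.continuous_radial.comp (by fun_prop)⟩ fun s => (h s).trans (track_cellMap ρ t s)
    · refine cell p _ (nf z).2.1 (.const _ (nf z).2.2) fun s => ?_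
      rw [h, track_of_ne hz]
      exact (cellMap_nf z).symm
  -- the paths in the complement of the barycenters
  have hA : ∀ {x y : SSet.toTop.obj K} (p : Path x y), (∀ s, (nf (p s)).1 ≤ n) →
      (∀ s, ¬ ∃ (ρ : K.nonDegenerate n) (t : stdSimplex ℝ (Fin (n + 1))),
        1 / 2 ≤ stdSimplex.depth t ∧ cellMap (n := ⦋n⦌) ρ.1 t = p s) → G (.mk p) := by
    intro x y p hp hd
    have hc : Continuous fun τ => track n (p τ) := continuous_iff_isClosed.2 fun A hA => by
      convert (isClosed_track (n := n) hA).preimage p.continuous using 1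
      ext τ
      exact ⟨fun h => ⟨hp τ, h⟩, fun h => h.2⟩
    have hc' : Continuous fun x : I × I => track n (p x.2) x.1 :=
      ContinuousEval.continuous_eval.comp ((hc.comp continuous_snd).prodMk continuous_fst)
    let p₁ : Path (track n (p 0) 1) (track n (p 1) 1) :=
      ⟨⟨fun τ => track n (p τ) 1, hc'.comp (f := fun τ => ((1 : I), τ)) (by fun_prop)⟩, rfl, rfl⟩
    let a : Path x (track n (p 0) 1) :=
      ⟨⟨fun s => track n (p 0) s, by fun_prop⟩, by simp [track_zero], rfl⟩
    let b : Path y (track n (p 1) 1) :=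
      ⟨⟨fun s => track n (p 1) s, by fun_prop⟩, by simp [track_zero], rfl⟩
    -- The expansion is a square with opposite sides `p` and `p₁`, the latter in the lower skeleton;
    -- the other two sides are tracks of endpoints and lie in single cells.
    have hsq := mk_square ⟨_, hc'⟩ p b p₁ a (fun τ => (track_zero n (p τ)).symm)
      (fun s => rfl) (fun τ => rfl) (fun s => rfl)
    have h1 : G (.mk p₁) := ih p₁ fun τ => by
      change (nf (track n (p τ) 1)).1 < n
      by_cases hz : (nf (p τ)).1 = n
      · obtain ⟨ρ, t, ht, h⟩ := exists_cellMap_of_nf_fst_eq hz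
        have hlt : stdSimplex.depth t < 1 / 2 := not_le.1 fun h' => hd τ ⟨ρ, t, h', h⟩
        obtain ⟨i, hi⟩ := stdSimplex.exists_radial_one_eq_zero hlt
        rw [← h, track_cellMap]
        exact nf_fst_lt_of_eq_zero ρ.1 hi
      · rw [track_of_ne hz]
        exact (hp τ).lt_of_ne hz
    have h2 : Path.Homotopic.Quotient.mk p =
        ((Path.Homotopic.Quotient.mk a).trans (.mk p₁)).trans (Path.Homotopic.Quotient.mk b).symm := by
      rw [← hsq, Path.Homotopic.Quotient.trans_assoc, Path.Homotopic.Quotient.trans_symm,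
        Path.Homotopic.Quotient.trans_refl]
    rw [h2]
    exact trans _ _ (trans _ _ (htrack _ a fun _ => rfl) h1) (symm _ (htrack _ b fun _ => rfl))
  -- An open cover of the interval: `none` stands for the times outside the cores of the n-cells,
  -- `some ρ` for the times in the open cell `ρ`. A fine enough subdivision leaves only pieces
  -- covered by `hA` or `hB`.
  let c : Option (K.nonDegenerate n) → Set I := fun o => o.elim
    (p ⁻¹' {z | ∃ (ρ : K.nonDegenerate n) (t : stdSimplex ℝ (Fin (n + 1))),
      1 / 2 ≤ stdSimplex.depth t ∧ cellMap (n := ⦋n⦌) ρ.1 t = z})ᶜ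
    (fun ρ => (p ⁻¹' {z | (nf z).1 ≤ n ∧ ∀ t : stdSimplex ℝ (Fin (n + 1)),
      (∀ i, 0 < t i) → cellMap (n := ⦋n⦌) ρ.1 t = z → t ∈ (∅ : Set _)})ᶜ)
  have hc₁ : ∀ o, IsOpen (c o) := by
    rintro (_ | ρ)
    · exact ((isClosed_depth n).preimage p.continuous).isOpen_compl
    · exact ((isClosed_cellSet ρ isClosed_empty).preimage p.continuous).isOpen_compl
  have hcρ : ∀ ρ s, s ∈ c (some ρ) → ∃ t : stdSimplex ℝ (Fin (n + 1)), (∀ i, 0 < t i) ∧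
      cellMap (n := ⦋n⦌) ρ.1 t = p s := by
    intro ρ s hs
    by_contra! h
    exact hs ⟨hp' s, fun t ht hts => h t ht hts⟩
  have hc₂ : Set.univ ⊆ ⋃ o, c o := by
    intro s _
    rw [Set.mem_iUnion]
    by_cases hz : (nf (p s)).1 = n
    · obtain ⟨ρ, t, ht, h⟩ := exists_cellMap_of_nf_fst_eq hz
      exact ⟨some ρ, fun h' => h'.2 t ht h⟩
    · refine ⟨none, ?_⟩
      rintro ⟨ρ, t, ht, h⟩
      apply hz
      rw [← h]
      obtain ht' | ⟨i, hi⟩ := pos_or_exists_eq_zero t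
      · rw [nf_cellMap_of_pos ρ ht']
      · rw [stdSimplex.depth_of_eq_zero hi] at ht
        norm_num at ht
  obtain ⟨t, ht0, htm, ⟨m, hm⟩, ht⟩ :=
    exists_monotone_Icc_subset_open_cover_unitInterval hc₁ hc₂
  have hpiece : ∀ k, G (.mk (p.subpath (t k) (t (k + 1)))) := by
    intro k
    obtain ⟨o, ho⟩ := ht k
    have hr : ∀ s, ∃ s' ∈ c o, p.subpath (t k) (t (k + 1)) s = p s' := by
      intro s
      have : p.subpath (t k) (t (k + 1)) s ∈ Set.range (p.subpath (t k) (t (k + 1))) := ⟨s, rfl⟩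
      rw [Path.range_subpath_of_le _ _ _ (htm k.le_succ)] at this
      obtain ⟨s', hs', h⟩ := this
      exact ⟨s', ho hs', h.symm⟩
    obtain _ | ρ := o
    · refine hA _ (fun s => ?_) fun s => ?_
      · obtain ⟨s', hs', h⟩ := hr s
        rw [h]
        exact hp' s'
      · obtain ⟨s', hs', h⟩ := hr s
        rw [h]
        exact hs'
    · refine hB _ ρ fun s => ?_
      obtain ⟨s', hs', h⟩ := hr s
      rw [h]
      exact hcρ ρ s' hs'
  have hsub : ∀ k, G (.mk (p.subpath 0 (t k))) := by
    intro k
    induction k with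
    | zero =>
      rw [ht0, Path.subpath_self]
      exact hrefl _
    | succ k ihk =>
      have := trans _ _ ihk (hpiece k)
      rw [← Path.Homotopic.Quotient.mk_trans,
        Path.Homotopic.Quotient.eq.2 ⟨Path.Homotopy.subpathTransSubpath p 0 (t k) (t (k + 1))⟩]
        at this
      exact this
  have := hsub m
  rw [hm m le_rfl, Path.subpath_zero_one] at this
  exact hcast _ _ _ this

end Realization

end

/-! ### Generation of the fundamental group by the edges -/

section

open unitInterval

namespace stdSimplex

instance simplyConnectedSpace (n : ℕ) : SimplyConnectedSpace (stdSimplex ℝ (Fin (n + 1))) := by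
  have : ContractibleSpace (stdSimplex ℝ (Fin (n + 1))) :=
    (convex_stdSimplex ℝ (Fin (n + 1))).contractibleSpace
      ⟨(vertex (S := ℝ) (0 : Fin (n + 1))).1, (vertex (S := ℝ) (0 : Fin (n + 1))).2⟩
  infer_instance

end stdSimplex

namespace Realization

variable {K : SSet.{u}}

/-- The homotopy class of paths `γ` is the image of a path from `s` to `t` in a simplex. -/
def IsArc {n : SimplexCategory} (ρ : K.obj (op n)) (s t : stdSimplex ℝ (Fin (n.len + 1)))
    {x y : SSet.toTop.obj K} (γ : Path.Homotopic.Quotient x y) : Prop :=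
  ∃ (q : Path s t) (p : Path x y), (∀ u, p u = cellMap ρ (q u)) ∧ γ = .mk p

namespace IsArc

variable {n : SimplexCategory} {ρ : K.obj (op n)} {s t r : stdSimplex ℝ (Fin (n.len + 1))}
  {x y z : SSet.toTop.obj K} {γ γ' : Path.Homotopic.Quotient x y}

lemma source (h : IsArc ρ s t γ) : x = cellMap ρ s := by
  obtain ⟨q, p, h, -⟩ := h
  simpa using h 0

lemma target (h : IsArc ρ s t γ) : y = cellMap ρ t := by
  obtain ⟨q, p, h, -⟩ := h
  simpa using h 1

lemma exists_mk (ρ : K.obj (op n)) (hx : x = cellMap ρ s) (hy : y = cellMap ρ t) :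
    ∃ γ : Path.Homotopic.Quotient x y, IsArc ρ s t γ := by
  subst hx hy
  let q := PathConnectedSpace.somePath s t
  exact ⟨_, q, q.map (cellMap ρ).continuous, fun u => rfl, rfl⟩

/-- A simplex is simply connected, so only the endpoints in the simplex matter. -/
lemma unique (h : IsArc ρ s t γ) (h' : IsArc ρ s t γ') : γ = γ' := by
  obtain rfl := h.source
  obtain rfl := h.target
  obtain ⟨q, p, h, rfl⟩ := h
  obtain ⟨q', p', h', rfl⟩ := h'
  obtain rfl : p = q.map (cellMap ρ).continuous := Path.ext (funext h)
  obtain rfl : p' = q'.map (cellMap ρ).continuous := Path.ext (funext h')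
  exact Path.Homotopic.Quotient.eq.2 ((SimplyConnectedSpace.paths_homotopic q q').map _)

lemma refl (h : x = cellMap ρ s) : IsArc ρ s s (Path.Homotopic.Quotient.refl x) := by
  subst h
  exact ⟨.refl _, .refl _, fun u => rfl, rfl⟩

lemma symm (h : IsArc ρ s t γ) : IsArc ρ t s γ.symm := by
  obtain ⟨q, p, h, rfl⟩ := h
  exact ⟨q.symm, p.symm, fun u => h _, rfl⟩

lemma trans {δ : Path.Homotopic.Quotient y z} (h : IsArc ρ s t γ) (h' : IsArc ρ t r δ) :
    IsArc ρ s r (γ.trans δ) := by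
  obtain ⟨q, p, h, rfl⟩ := h
  obtain ⟨q', p', h', rfl⟩ := h'
  refine ⟨q.trans q', p.trans p', fun u => ?_, rfl⟩
  rw [Path.trans_apply, Path.trans_apply]
  split_ifs
  · exact h _
  · exact h' _

lemma map {m : SimplexCategory} {f : m ⟶ n} {s t : stdSimplex ℝ (Fin (m.len + 1))}
    (h : IsArc (K.map f.op ρ) s t γ) : IsArc ρ (stdSimplex.map f s) (stdSimplex.map f t) γ := by
  obtain ⟨q, p, h, rfl⟩ := h
  exact ⟨q.map (stdSimplex.continuous_map f), p, fun u => (h u).trans (cellMap_map _ _ _), rfl⟩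

end IsArc

/-- The class of the path given by an edge. -/
abbrev IsEdge (e : K _⦋1⦌) {x y : SSet.toTop.obj K} (γ : Path.Homotopic.Quotient x y) : Prop :=
  IsArc (n := ⦋1⦌) e (stdSimplex.vertex (S := ℝ) (0 : Fin 2))
    (stdSimplex.vertex (S := ℝ) (1 : Fin 2)) γ

/-- The edge between two vertices of a simplex. -/
def edgeHom {n : SimplexCategory} {i j : Fin (n.len + 1)} (h : i ≤ j) : ⦋1⦌ ⟶ n :=
  SimplexCategory.Hom.mk ⟨![i, j], by
    intro a b hab
    fin_cases a <;> fin_cases b <;> simp_all⟩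

lemma IsEdge.isArc {n : SimplexCategory} {i j : Fin (n.len + 1)} {h : i ≤ j} {ρ : K.obj (op n)}
    {x y : SSet.toTop.obj K} {γ : Path.Homotopic.Quotient x y}
    (hγ : IsEdge (K.map (edgeHom h).op ρ) γ) :
    IsArc ρ (stdSimplex.vertex i) (stdSimplex.vertex j) γ := by
  convert IsArc.map hγ using 1
  · exact (stdSimplex.map_vertex (S := ℝ) (edgeHom h) (0 : Fin 2)).symm
  · exact (stdSimplex.map_vertex (S := ℝ) (edgeHom h) (1 : Fin 2)).symm

lemma IsEdge.comp {ρ : K _⦋2⦌} {x y z : SSet.toTop.obj K} {α : Path.Homotopic.Quotient x y}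
    {β : Path.Homotopic.Quotient y z} {γ : Path.Homotopic.Quotient x z}
    (hα : IsEdge (K.map (edgeHom (n := ⦋2⦌) (i := (0 : Fin 3)) (j := (1 : Fin 3)) (by decide)).op ρ) α)
    (hβ : IsEdge (K.map (edgeHom (n := ⦋2⦌) (i := (1 : Fin 3)) (j := (2 : Fin 3)) (by decide)).op ρ) β)
    (hγ : IsEdge (K.map (edgeHom (n := ⦋2⦌) (i := (0 : Fin 3)) (j := (2 : Fin 3)) (by decide)).op ρ) γ) :
    γ = α.trans β :=
  (IsEdge.isArc hγ).unique ((IsEdge.isArc hα).trans (IsEdge.isArc hβ))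

lemma IsEdge.degenerate {v : K _⦋0⦌} {f : ⦋1⦌ ⟶ ⦋0⦌} {x : SSet.toTop.obj K}
    {γ : Path.Homotopic.Quotient x x} (h : IsEdge (K.map f.op v) γ) : γ = .refl x := by
  have := IsArc.map h
  rw [Subsingleton.elim (stdSimplex.map f (stdSimplex.vertex (1 : Fin 2)))
    (stdSimplex.map f (stdSimplex.vertex (0 : Fin 2)))] at this
  exact this.unique (.refl this.source)

section

variable {x₀ : SSet.toTop.obj K}

/-- The classes of paths from the base point to a point which are concatenations of a loop in `N`
and a path in a simplex. -/
def cellClass (N : Path.Homotopic.Quotient x₀ x₀ → Prop) {n : SimplexCategory}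
    (ρ : K.obj (op n)) (t : stdSimplex ℝ (Fin (n.len + 1))) (z : SSet.toTop.obj K) :
    Set (Path.Homotopic.Quotient x₀ z) :=
  {γ | ∃ a, N a ∧ ∃ b : Path.Homotopic.Quotient x₀ z,
    IsArc ρ (stdSimplex.vertex 0) t b ∧ γ = a.trans b}

variable (hx₀ : ∀ {n : SimplexCategory} (ρ : K.obj (op n)) (i : Fin (n.len + 1)),
  x₀ = cellMap ρ (stdSimplex.vertex i))
include hx₀

/-- The simplex and its face use the base vertices `0` and `f 0` of `ρ`. Changing between them costs
the edge from `0` to `f 0`, a loop which belongs to `N`. -/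
lemma cellClass_map {N : Path.Homotopic.Quotient x₀ x₀ → Prop}
    (htrans : ∀ a b, N a → N b → N (a.trans b)) (hsymm : ∀ a, N a → N a.symm)
    (hedge : ∀ (e : K _⦋1⦌) γ, IsEdge e γ → N γ) {m n : SimplexCategory} (f : m ⟶ n)
    (ρ : K.obj (op n)) (t : stdSimplex ℝ (Fin (m.len + 1))) :
    cellClass N (K.map f.op ρ) t = cellClass N ρ (stdSimplex.map f t) := by
  ext z γ
  obtain ⟨b, hb⟩ := IsArc.exists_mk (K.map (edgeHom (Fin.zero_le (f.toOrderHom 0))).op ρ)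
    (s := stdSimplex.vertex (S := ℝ) (0 : Fin 2)) (t := stdSimplex.vertex (S := ℝ) (1 : Fin 2))
    (hx₀ (n := ⦋1⦌) _ _) (hx₀ (n := ⦋1⦌) _ _)
  have hbN : N b := hedge _ _ hb
  have hb := IsEdge.isArc hb
  have hmap : ∀ {a : Path.Homotopic.Quotient x₀ z},
      IsArc (K.map f.op ρ) (stdSimplex.vertex 0) t a →
      IsArc ρ (stdSimplex.vertex (f.toOrderHom 0)) (stdSimplex.map f t) a := fun h => by
    convert IsArc.map h using 1
    exact (stdSimplex.map_vertex (S := ℝ) f 0).symm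
  constructor
  · rintro ⟨a, ha, c, hc, rfl⟩
    refine ⟨a.trans b.symm, htrans _ _ ha (hsymm _ hbN), _, hb.trans (hmap hc), ?_⟩
    rw [Path.Homotopic.Quotient.trans_assoc, ← Path.Homotopic.Quotient.trans_assoc b.symm,
      Path.Homotopic.Quotient.symm_trans, Path.Homotopic.Quotient.refl_trans]
  · rintro ⟨a, ha, c, hc, rfl⟩
    obtain ⟨d, hd⟩ := IsArc.exists_mk (K.map f.op ρ) (s := stdSimplex.vertex 0) (t := t)
      (hx₀ _ _) (hc.target.trans (cellMap_map f ρ t).symm)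
    refine ⟨a.trans b, htrans _ _ ha hbN, d, hd, ?_⟩
    rw [Path.Homotopic.Quotient.trans_assoc, hc.unique (hb.trans (hmap hd))]

/-- The fundamental group of the realization of a simplicial set with one vertex is generated by
the classes of the edges. -/
theorem loop_induction {N : Path.Homotopic.Quotient x₀ x₀ → Prop} (hrefl : N (.refl x₀))
    (htrans : ∀ a b, N a → N b → N (a.trans b)) (hsymm : ∀ a, N a → N a.symm)
    (hedge : ∀ (e : K _⦋1⦌) γ, IsEdge e γ → N γ) (γ : Path.Homotopic.Quotient x₀ x₀) : N γ := by
  -- For a subgroup `N`, these cosets are the part over `z` of a section of the covering belonging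
  -- to `N`. Transport along arcs preserves them, hence so does transport along all paths; over `x₀`
  -- the set is `N` itself.
  let T (z : SSet.toTop.obj K) : Set (Path.Homotopic.Quotient x₀ z) :=
    cellClass N (n := ⦋(nf z).1⦌) (nf z).2.1.1 (nf z).2.2 z
  have hT : ∀ {n : SimplexCategory} {ρ : K.obj (op n)} {t} {z : SSet.toTop.obj K},
      z = cellMap ρ t → T z = cellClass N ρ t z := fun {n ρ t z} h => by
    subst h
    exact congrFun (cellMap_nf_desc (fun n ρ t => cellClass N ρ t)
      (fun m n f ρ t => cellClass_map hx₀ htrans hsymm hedge f ρ t) ρ t) _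
  have key : ∀ {x y : SSet.toTop.obj K} {n : SimplexCategory} {ρ : K.obj (op n)} {s t}
      {p : Path.Homotopic.Quotient x y}, IsArc ρ s t p → ∀ α ∈ T x, α.trans p ∈ T y := by
    intro x y n ρ s t p hp α hα
    rw [hT hp.source] at hα
    rw [hT hp.target]
    obtain ⟨a, ha, b, hb, rfl⟩ := hα
    exact ⟨a, ha, _, hb.trans hp, Path.Homotopic.Quotient.trans_assoc _ _ _⟩
  -- Transport in both directions is carried along so that the property is stable under inversion.
  have main := path_induction (K := K) (G := fun {x y} p =>
      (∀ α ∈ T x, α.trans p ∈ T y) ∧ ∀ α ∈ T y, α.trans p.symm ∈ T x)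
    (fun p q hp hq => ⟨fun α hα => ?_, fun α hα => ?_⟩)
    (fun p hp => ⟨hp.2, fun α hα => ?_⟩)
    (fun {x y} p n ρ q hp => ?_) γ
  · have h1 : x₀ = cellMap (nf x₀).2.1.1 (stdSimplex.vertex 0) := hx₀ (n := ⦋(nf x₀).1⦌) _ _
    have h2 : Path.Homotopic.Quotient.refl x₀ ∈ T x₀ := by
      rw [hT h1]
      exact ⟨_, hrefl, _, .refl h1, (Path.Homotopic.Quotient.refl_trans _).symm⟩
    have h3 := main.1 _ h2
    rw [hT h1, Path.Homotopic.Quotient.refl_trans] at h3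
    obtain ⟨a, ha, b, hb, rfl⟩ := h3
    obtain rfl := hb.unique (.refl h1)
    rwa [Path.Homotopic.Quotient.trans_refl]
  · rw [← Path.Homotopic.Quotient.trans_assoc]
    exact hq.1 _ (hp.1 _ hα)
  · have : (p.trans q).symm = q.symm.trans p.symm := by
      induction p using Path.Homotopic.Quotient.ind with | mk p =>
      induction q using Path.Homotopic.Quotient.ind with | mk q =>
      rw [← Path.Homotopic.Quotient.mk_trans, ← Path.Homotopic.Quotient.mk_symm,
        Path.trans_symm]
      rfl
    rw [this, ← Path.Homotopic.Quotient.trans_assoc]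
    exact hp.2 _ (hq.2 _ hα)
  · have : p.symm.symm = p := by
      induction p using Path.Homotopic.Quotient.ind with | mk p =>
      rw [← Path.Homotopic.Quotient.mk_symm, ← Path.Homotopic.Quotient.mk_symm, Path.symm_symm]
    rw [this]
    exact hp.1 _ hα
  · have h : IsArc (n := ⦋n⦌) ρ.1 (q 0) (q 1) (.mk p) := ⟨⟨q, rfl, rfl⟩, p, hp, rfl⟩
    exact ⟨key h, key h.symm⟩

end

lemma realizationVertex_eq (x : K _⦋0⦌) (t : stdSimplex ℝ (Fin 1)) :
    realizationVertex x = cellMap (n := ⦋0⦌) x t := by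
  rw [Subsingleton.elim t (default : stdSimplex ℝ (Fin 1))]
  rfl

lemma isEdge_realizationPath {x y : K _⦋0⦌} (e : SSet.Edge x y) :
    IsEdge e.edge (.mk (realizationPath e)) := by
  refine ⟨⟨⟨stdSimplexHomeomorphUnitInterval.symm, by fun_prop⟩, ?_, ?_⟩, realizationPath e,
    fun u => ?_, rfl⟩
  · exact stdSimplexHomeomorphUnitInterval.injective (by simp)
  · exact stdSimplexHomeomorphUnitInterval.injective (by simp)
  · rfl

end Realization

end

/-! ### Step functions -/

section

open unitInterval

namespace stdSimplex

variable {n : ℕ}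

/-- The index of the interval containing `x` in the subdivision of `[0, 1)` into intervals whose
lengths are the barycentric coordinates of a point. -/
noncomputable def index (t : stdSimplex ℝ (Fin (n + 1))) (x : Set.Ico (0 : ℝ) 1) : Fin (n + 1) :=
  (Finset.univ.filter fun k => x.1 < ∑ i ∈ Finset.Iic k, t i).min' ⟨Fin.last n, by
    have h : Finset.Iic (Fin.last n) = Finset.univ := by ext; simp [Fin.le_last]
    simp only [Finset.mem_filter, Finset.mem_univ, true_and, h]
    exact (sum_eq_one t).symm ▸ x.2.2⟩

lemma lt_sum_index (t : stdSimplex ℝ (Fin (n + 1))) (x : Set.Ico (0 : ℝ) 1) :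
    x.1 < ∑ i ∈ Finset.Iic (index t x), t i :=
  (Finset.mem_filter.1 (Finset.min'_mem (Finset.univ.filter fun k => x.1 < ∑ i ∈ Finset.Iic k, t i)
    _)).2

lemma sum_le_of_lt_index {t : stdSimplex ℝ (Fin (n + 1))} {x : Set.Ico (0 : ℝ) 1} {k}
    (h : k < index t x) : ∑ i ∈ Finset.Iic k, t i ≤ x.1 := by
  by_contra! h'
  exact h.not_ge (Finset.min'_le _ _ (by simpa using h'))

lemma sum_index_le (t : stdSimplex ℝ (Fin (n + 1))) (x : Set.Ico (0 : ℝ) 1) :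
    ∑ i ∈ Finset.Iio (index t x), t i ≤ x.1 := by
  by_cases h : index t x = 0
  · rw [h, Finset.sum_eq_zero]
    · exact x.2.1
    · intro i hi
      simp at hi
  · obtain ⟨k, hk⟩ := Fin.exists_succ_eq.2 h
    have : Finset.Iio (index t x) = Finset.Iic k.castSucc := by
      ext i
      rw [← hk, Finset.mem_Iio, Finset.mem_Iic, Fin.lt_def, Fin.le_def]
      simp
    rw [this]
    refine sum_le_of_lt_index ?_
    rw [← hk]
    exact Fin.castSucc_lt_succ

lemma index_mem_iff (t : stdSimplex ℝ (Fin (n + 1))) (x : Set.Ico (0 : ℝ) 1)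
    {A : Finset (Fin (n + 1))} (hA : IsLowerSet (A : Set (Fin (n + 1)))) :
    index t x ∈ A ↔ x.1 < ∑ i ∈ A, t i := by
  constructor
  · intro h
    refine (lt_sum_index t x).trans_le (Finset.sum_le_sum_of_subset_of_nonneg ?_
      fun i _ _ => zero_le t i)
    exact fun i hi => hA (Finset.mem_Iic.1 hi) h
  · intro h
    by_contra h'
    refine h.not_ge ((Finset.sum_le_sum_of_subset_of_nonneg ?_
      fun i _ _ => zero_le t i).trans (sum_index_le t x))
    exact fun i hi => Finset.mem_Iio.2 (not_le.1 fun hle => h' (hA hle hi))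

lemma index_le_iff {t : stdSimplex ℝ (Fin (n + 1))} {x : Set.Ico (0 : ℝ) 1} {k} :
    index t x ≤ k ↔ x.1 < ∑ i ∈ Finset.Iic k, t i := by
  rw [← index_mem_iff t x (A := Finset.Iic k) (fun i j h hi => by simp_all; exact h.trans hi),
    Finset.mem_Iic]

/-- As `f` is monotone, the indices `i` with `f i ≤ k` form an initial segment: pushing forward only
merges neighbouring intervals and inserts empty ones. -/
lemma index_map {m : ℕ} (f : Fin (m + 1) →o Fin (n + 1)) (t : stdSimplex ℝ (Fin (m + 1)))
    (x : Set.Ico (0 : ℝ) 1) : index (map f t) x = f (index t x) := by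
  refine eq_of_forall_ge_iff fun k => ?_
  have h : ∑ i ∈ Finset.Iic k, map f t i = ∑ i with f i ≤ k, t i := by
    simp only [map_apply_eq_sum]
    rw [← Finset.sum_fiberwise_of_maps_to (s := Finset.univ.filter fun i => f i ≤ k)
      (t := Finset.Iic k) (g := f) (fun i hi => by simpa using hi)]
    refine Finset.sum_congr rfl fun j hj => Finset.sum_congr ?_ fun _ _ => rfl
    ext i
    simp only [Finset.mem_filter, Finset.mem_univ, true_and]
    exact ⟨fun h => ⟨h ▸ Finset.mem_Iic.1 hj, h⟩, fun h => h.2⟩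
  rw [index_le_iff, h, ← index_mem_iff t x (A := Finset.univ.filter fun i => f i ≤ k)
    (fun i j h hi => by simp_all; exact (f.monotone h).trans hi)]
  simp

lemma index_vertex (k : Fin (n + 1)) (x : Set.Ico (0 : ℝ) 1) : index (vertex k) x = k := by
  have h := index_map (OrderHom.const (Fin 1) k) (vertex (S := ℝ) (0 : Fin 1)) x
  rwa [map_vertex] at h

end stdSimplex

/-- Functions on the interval `[0, 1)`, with the distance given by the measure of the set where
two functions differ. -/
def StepFun (H : Type*) : Type _ := Set.Ico (0 : ℝ) 1 → H

namespace StepFun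

open MeasureTheory

variable {H : Type*} [AddCommGroup H]

instance : AddCommGroup (StepFun H) := inferInstanceAs (AddCommGroup (Set.Ico (0 : ℝ) 1 → H))

lemma volume_image_ne_top (A : Set (Set.Ico (0 : ℝ) 1)) : volume (Subtype.val '' A) ≠ ⊤ := by
  refine ne_top_of_le_ne_top (b := volume (Set.Ico (0 : ℝ) 1)) (by simp) (measure_mono ?_)
  rintro _ ⟨x, -, rfl⟩
  exact x.2

/-- The measure of the support. -/
noncomputable def seminorm (H : Type*) [AddCommGroup H] : AddGroupSeminorm (StepFun H) where
  toFun f := volume.real (Subtype.val '' {x | f x ≠ 0})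
  map_zero' := by
    have : {x | (0 : StepFun H) x ≠ 0} = ∅ :=
      Set.eq_empty_of_forall_notMem fun x hx => hx rfl
    rw [this]
    simp
  add_le' f g := by
    refine (measureReal_mono ?_ ?_).trans (measureReal_union_le _ _)
    · rw [← Set.image_union]
      refine Set.image_mono fun x hx => ?_
      by_contra h
      simp only [Set.mem_union, Set.mem_ofPred_eq, not_or, not_not] at h
      exact hx (show f x + g x = 0 by rw [h.1, h.2, add_zero])
    · rw [← Set.image_union]
      exact volume_image_ne_top _
  neg' f := by
    have : {x | (-f) x ≠ 0} = {x | f x ≠ 0} := by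
      ext x
      exact neg_ne_zero (a := f x)
    rw [this]

noncomputable instance : SeminormedAddCommGroup (StepFun H) :=
  (seminorm H).toSeminormedAddCommGroup

lemma dist_eq (f g : StepFun H) :
    dist f g = volume.real (Subtype.val '' {x | f x ≠ g x}) := by
  rw [dist_eq_norm]
  change volume.real (Subtype.val '' {x | f x - g x ≠ 0}) = _
  simp only [sub_ne_zero]

/-- The constant functions. -/
def const (H : Type*) [AddCommGroup H] : H →+ StepFun H where
  toFun h := fun _ => h
  map_zero' := rfl
  map_add' _ _ := rfl

lemma const_apply (h : H) (x : Set.Ico (0 : ℝ) 1) : const H h x = h := rfl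

/-- Distinct constants differ on the whole interval and so have distance 1. -/
lemma isDiscrete_const : IsDiscrete ((const H).range : Set (StepFun H)) := by
  have : DiscreteTopology (const H).range := by
    refine DiscreteTopology.of_forall_le_dist one_pos ?_
    rintro ⟨_, h, rfl⟩ ⟨_, h', rfl⟩ hne
    rw [Subtype.dist_eq, dist_eq]
    have : {x | const H h x ≠ const H h' x} = Set.univ :=
      Set.eq_univ_of_forall fun x hx => hne (Subtype.ext (congrArg (const H) hx))
    rw [this, Set.image_univ, Subtype.range_coe, Real.volume_real_Ico]
    simp
  exact ⟨this⟩

/-- Step functions with varying lengths of the steps. -/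
noncomputable def step {n : ℕ} (c : Fin (n + 1) → H) (t : stdSimplex ℝ (Fin (n + 1))) :
    StepFun H := fun x => c (stdSimplex.index t x)

/-- If the indices of `x` for `s` and `t` differ and `k` is the smaller one, then `x` lies between
the k-th partial sums of `s` and `t`. -/
lemma dist_step_le {n : ℕ} (c : Fin (n + 1) → H) (s t : stdSimplex ℝ (Fin (n + 1))) :
    dist (step c s) (step c t) ≤
      ∑ k, |∑ i ∈ Finset.Iic k, s i - ∑ i ∈ Finset.Iic k, t i| := by
  rw [dist_eq]
  have : Subtype.val '' {x | step c s x ≠ step c t x} ⊆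
      ⋃ k, Set.uIcc (∑ i ∈ Finset.Iic k, t i) (∑ i ∈ Finset.Iic k, s i) := by
    rintro _ ⟨x, hx, rfl⟩
    have hne : stdSimplex.index s x ≠ stdSimplex.index t x := fun h => hx (congrArg c h)
    rw [Set.mem_iUnion]
    obtain h | h := hne.lt_or_gt
    · exact ⟨stdSimplex.index s x, Set.mem_uIcc.2 (.inl
        ⟨stdSimplex.sum_le_of_lt_index h, (stdSimplex.lt_sum_index s x).le⟩)⟩
    · exact ⟨stdSimplex.index t x, Set.mem_uIcc.2 (.inr
        ⟨stdSimplex.sum_le_of_lt_index h, (stdSimplex.lt_sum_index t x).le⟩)⟩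
  refine (measureReal_mono this ?_).trans ((measureReal_iUnion_fintype_le _).trans_eq ?_)
  · exact ((isCompact_iUnion fun k => isCompact_uIcc).measure_lt_top).ne
  · refine Finset.sum_congr rfl fun k _ => ?_
    rw [Measure.real, Real.volume_interval, ENNReal.toReal_ofReal (abs_nonneg _)]

lemma continuous_step {n : ℕ} (c : Fin (n + 1) → H) : Continuous (step c) := by
  refine continuous_iff_continuousAt.2 fun t => tendsto_iff_dist_tendsto_zero.2 ?_
  refine squeeze_zero (fun _ => dist_nonneg) (fun s => dist_step_le c s t) ?_
  have : Continuous fun s : stdSimplex ℝ (Fin (n + 1)) =>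
      ∑ k, |∑ i ∈ Finset.Iic k, s i - ∑ i ∈ Finset.Iic k, t i| :=
    continuous_finsetSum _ fun k _ => ((continuous_finsetSum _ fun i _ =>
      stdSimplex.continuous_apply' i).sub continuous_const).abs
  simpa using this.tendsto t

lemma step_vertex {n : ℕ} (c : Fin (n + 1) → H) (k) :
    step c (stdSimplex.vertex k) = const H (c k) :=
  funext fun x => congrArg c (stdSimplex.index_vertex k x)

end StepFun

/-! ### The classifying map of an additive function on edges -/

namespace Realization

variable {K : SSet.{u}} {H : Type*} [AddCommGroup H]

lemma map_edgeHom_map {m n : SimplexCategory} (f : m ⟶ n) (ρ : K.obj (op n))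
    {i j : Fin (m.len + 1)} (h : i ≤ j) : K.map (edgeHom h).op (K.map f.op ρ) =
      K.map (edgeHom (f.toOrderHom.monotone h)).op ρ := by
  have : edgeHom (f.toOrderHom.monotone h) = edgeHom h ≫ f := by
    ext a : 3
    fin_cases a <;> rfl
  rw [this, op_comp, Functor.map_comp]
  rfl

/-- The triangle with given vertices in a simplex. -/
def triangleHom {n : SimplexCategory} {i j k : Fin (n.len + 1)} (h : i ≤ j) (h' : j ≤ k) :
    ⦋2⦌ ⟶ n :=
  SimplexCategory.Hom.mk ⟨![i, j, k], by
    have := h.trans h'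
    intro a b hab
    fin_cases a <;> fin_cases b <;> simp_all⟩

/-- An additive function on the edges of a simplicial set. -/
def IsAdditive (φ : K _⦋1⦌ → H) : Prop :=
  ∀ ρ : K _⦋2⦌,
    φ (K.map (edgeHom (n := ⦋2⦌) (i := (0 : Fin 3)) (j := (2 : Fin 3)) (by decide)).op ρ) =
      φ (K.map (edgeHom (n := ⦋2⦌) (i := (0 : Fin 3)) (j := (1 : Fin 3)) (by decide)).op ρ) +
      φ (K.map (edgeHom (n := ⦋2⦌) (i := (1 : Fin 3)) (j := (2 : Fin 3)) (by decide)).op ρ)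

lemma IsAdditive.add {φ : K _⦋1⦌ → H} (hφ : IsAdditive φ) {n : SimplexCategory} (ρ : K.obj (op n))
    {i j k : Fin (n.len + 1)} (h : i ≤ j) (h' : j ≤ k) :
    φ (K.map (edgeHom (h.trans h')).op ρ) =
      φ (K.map (edgeHom h).op ρ) + φ (K.map (edgeHom h').op ρ) := by
  have := hφ (K.map (triangleHom h h').op ρ)
  simp only [map_edgeHom_map] at this
  exact this

/-- The step function given by a point of a simplex and an additive function on the edges. -/
noncomputable def cellStep (φ : K _⦋1⦌ → H) {n : SimplexCategory} (ρ : K.obj (op n))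
    (t : stdSimplex ℝ (Fin (n.len + 1))) : StepFun H :=
  .step (fun i => φ (K.map (edgeHom (Fin.zero_le i)).op ρ)) t

/-- Both step functions belong to the same index in `t`, by `index_map`; their values are φ of the
edges to one common vertex from `f 0` and from `0`. By additivity they differ by φ of the edge from
`0` to `f 0`, which is why constants are divided out. -/
lemma mk_cellStep_map {φ : K _⦋1⦌ → H} (hφ : IsAdditive φ) {m n : SimplexCategory} (f : m ⟶ n)
    (ρ : K.obj (op n)) (t : stdSimplex ℝ (Fin (m.len + 1))) :
    (cellStep φ (K.map f.op ρ) t : StepFun H ⧸ (StepFun.const H).range) =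
      cellStep φ ρ (stdSimplex.map f t) := by
  rw [QuotientAddGroup.eq]
  refine ⟨φ (K.map (edgeHom (Fin.zero_le (f.toOrderHom 0))).op ρ), funext fun x => ?_⟩
  have h1 : stdSimplex.index (stdSimplex.map f t) x = f.toOrderHom (stdSimplex.index t x) :=
    stdSimplex.index_map f.toOrderHom t x
  have h2 := hφ.add ρ (Fin.zero_le (f.toOrderHom 0))
    (f.toOrderHom.monotone (Fin.zero_le (stdSimplex.index t x)))
  change φ _ = -φ (K.map (edgeHom _).op (K.map f.op ρ)) + φ (K.map (edgeHom _).op ρ)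
  rw [map_edgeHom_map, eq_neg_add_iff_add_eq, add_comm, ← h2]
  congr!
  exact h1.symm

/-- The map from the realization to a classifying space given by an additive function on the
edges. -/
noncomputable def classifying (φ : K _⦋1⦌ → H) (z : SSet.toTop.obj K) :
    StepFun H ⧸ (StepFun.const H).range :=
  cellStep φ (n := ⦋(nf z).1⦌) (nf z).2.1.1 (nf z).2.2

lemma classifying_cellMap {φ : K _⦋1⦌ → H} (hφ : IsAdditive φ) {n : SimplexCategory}
    (ρ : K.obj (op n)) (t) : classifying φ (cellMap ρ t) = cellStep φ ρ t :=
  cellMap_nf_desc (fun _ ρ t => (cellStep φ ρ t : StepFun H ⧸ (StepFun.const H).range))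
    (fun _ _ f ρ t => mk_cellStep_map hφ f ρ t) ρ t

lemma continuous_classifying {φ : K _⦋1⦌ → H} (hφ : IsAdditive φ) : Continuous (classifying φ) := by
  refine continuous_of_comp_cellMap fun n ρ => ?_
  simp only [classifying_cellMap hφ]
  exact continuous_quotient_mk'.comp (StepFun.continuous_step (n := n)
    fun i => φ (K.map (edgeHom (n := ⦋n⦌) (Fin.zero_le i)).op ρ.1))

/-- An additive function on the edges of a simplicial set with one vertex induces a homomorphism
from the fundamental group of the realization. -/
theorem exists_hom_of_isAdditive {x₀ : SSet.toTop.obj K}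
    (hx₀ : ∀ {n : SimplexCategory} (ρ : K.obj (op n)) (i : Fin (n.len + 1)),
      x₀ = cellMap ρ (stdSimplex.vertex i)) {φ : K _⦋1⦌ → H} (hφ : IsAdditive φ) :
    ∃ Φ : Path.Homotopic.Quotient x₀ x₀ → H, (∀ a b, Φ (a.trans b) = Φ a + Φ b) ∧
      ∀ (e : K _⦋1⦌) γ, IsEdge e γ → Φ γ = φ e := by
  -- Since the constants form a discrete subgroup, the quotient map is a covering with the constants
  -- as its group; lifting loops gives the homomorphism.
  have hcov := AddSubgroup.isAddQuotientCoveringMap_of_comm (StepFun.const H).range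
    StepFun.isDiscrete_const
  have hrefl : ∀ {n : SimplexCategory} (ρ : K.obj (op n)) (i : Fin (n.len + 1)),
      φ (K.map (edgeHom (le_refl i)).op ρ) = 0 := fun ρ i => by
    simpa using hφ.add ρ (le_refl i) (le_refl i)
  have hstep : ∀ {n : SimplexCategory} (ρ : K.obj (op n)),
      cellStep φ ρ (stdSimplex.vertex 0) = 0 := fun ρ => by
    rw [cellStep, StepFun.step_vertex]
    exact (congrArg _ (hrefl ρ 0)).trans (map_zero _)
  let F : C(SSet.toTop.obj K, StepFun H ⧸ (StepFun.const H).range) :=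
    ⟨classifying φ, continuous_classifying hφ⟩
  have h0 : ((0 : StepFun H) : StepFun H ⧸ (StepFun.const H).range) = F x₀ := by
    rw [hx₀ (n := ⦋(nf x₀).1⦌) (nf x₀).2.1.1 0, ← hstep (n := ⦋(nf x₀).1⦌) (nf x₀).2.1.1]
    exact (classifying_cellMap hφ _ _).symm
  let e₀ : (QuotientAddGroup.mk : _ → StepFun H ⧸ (StepFun.const H).range) ⁻¹' {F x₀} := ⟨0, h0⟩
  let Ψ := hcov.fundamentalGroupToMulOpposite e₀
  have hΨ : ∀ γ, ((Ψ γ).unop.toAdd : StepFun H) = hcov.isCoveringMap.monodromy γ e₀ := fun γ => by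
    have := hcov.unop_fundamentalGroupToMulOpposite_smul (e := e₀) (γ := γ)
    rw [← this]
    exact (add_zero _).symm
  -- The values of the monodromy are constant functions, so evaluation at any point recovers the
  -- element of `H`.
  let p₀ : Set.Ico (0 : ℝ) 1 := ⟨0, by simp⟩
  refine ⟨fun γ => ((Ψ (γ.map F)).unop.toAdd : StepFun H) p₀, fun a b => ?_, fun e γ h => ?_⟩
  · have h1 : (a.trans b).map F = (a.map F).trans (b.map F) := by
      induction a using Path.Homotopic.Quotient.ind with | mk a =>
      induction b using Path.Homotopic.Quotient.ind with | mk b =>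
      exact congrArg Path.Homotopic.Quotient.mk (Path.map_trans a b F.continuous)
    -- The product in the fundamental group is concatenation in the reverse order; the opposite
    -- group in the target compensates.
    have h2 : Ψ ((a.map F).trans (b.map F)) = Ψ (b.map F) * Ψ (a.map F) :=
      Ψ.map_mul (b.map F) (a.map F)
    simp only [h1, h2]
    rfl
  · simp only [hΨ]
    obtain ⟨q, p, hp, rfl⟩ := h
    have hstep₁ : cellStep φ (n := ⦋1⦌) e (stdSimplex.vertex (1 : Fin 2)) =
        StepFun.const H (φ e) := by
      have : edgeHom (n := ⦋1⦌) (Fin.zero_le (1 : Fin 2)) = 𝟙 _ := by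
        ext a : 3
        fin_cases a <;> rfl
      refine (StepFun.step_vertex _ _).trans (congrArg (fun x => StepFun.const H (φ x)) ?_)
      simp [this]
    -- An explicit lift of the edge, which moves from 0 to the constant `φ e`.
    let Γ : Path (0 : StepFun H) (StepFun.const H (φ e)) :=
      ⟨⟨fun u => cellStep φ (n := ⦋1⦌) e (q u), (StepFun.continuous_step _).comp q.continuous⟩,
        by simpa using hstep (n := ⦋1⦌) e, by
        simpa using hstep₁⟩
    have h1 : QuotientAddGroup.mk (StepFun.const H (φ e)) = F x₀ := by
      rw [← h0, QuotientAddGroup.eq]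
      exact ⟨-φ e, by simp⟩
    have := hcov.isCoveringMap.monodromy_eq_of_map_eq (γ := (Path.Homotopic.Quotient.mk p).map F)
      (ex := e₀) (ey := ⟨_, h1⟩) (.mk Γ) (by
        refine congrArg Path.Homotopic.Quotient.mk (Path.ext (funext fun u => ?_))
        exact (classifying_cellMap hφ _ _).symm.trans (congrArg F (hp u).symm))
    rw [this]
    rfl

end Realization

end

/-! ### Edges of the diagonal and their classes -/

namespace CategoryTheory.ComposableArrows

lemma eq_mk₁_map {D : Type*} [Category* D] (G : ComposableArrows D 1) :
    G = mk₁ (G.map (homOfLE (zero_le_one (α := Fin 2)))) :=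
  ext₁ rfl rfl ((Category.id_comp _).trans (Category.comp_id _)).symm

end CategoryTheory.ComposableArrows

namespace SWData

open Realization

variable {C : Type u} [Category.{v} C] (S : SWData C)

/-- The diagonal of the bisimplicial set `w_• S̃_• C`. -/
abbrev diag : SSet.{max u v} := bisimplicialDiagonal S.wSTildeNerve

/-- The simplices of the diagonal are the composable arrows in `w S̃ₙ C`. -/
def simplex {n : SimplexCategory} (F : Fin (n.len + 1) ⥤ STilde S n) : S.diag.obj (op n) := F

lemma map_edgeHom_simplex {n : SimplexCategory} (F : Fin (n.len + 1) ⥤ STilde S n)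
    {i j : Fin (n.len + 1)} (h : i ≤ j) : S.diag.map (edgeHom h).op (S.simplex F) =
      S.simplex (n := ⦋1⦌)
        (ComposableArrows.mk₁ ((STilde.pull (edgeHom h)).map (F.map (homOfLE h)))) :=
  ComposableArrows.eq_mk₁_map (D := STilde S ⦋1⦌) _

lemma edge_surjective (e : S.diag _⦋1⦌) : ∃ (A B : STilde S ⦋1⦌) (f : A ⟶ B),
    e = S.simplex (n := ⦋1⦌) (ComposableArrows.mk₁ f) :=
  ComposableArrows.mk₁_surjective (C := STilde S ⦋1⦌) e

lemma basePoint_eq {n : SimplexCategory} (ρ : S.diag.obj (op n)) (i : Fin (n.len + 1)) :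
    S.basePoint = cellMap ρ (stdSimplex.vertex i) := by
  rw [basePoint, ← S.eq_baseVertex (S.diag.map (SimplexCategory.const ⦋0⦌ n i).op ρ),
    realizationVertex_eq _ (stdSimplex.vertex 0), cellMap_map, stdSimplex.map_vertex]
  rfl

lemma exists_isEdge (e : S.diag _⦋1⦌) :
    ∃ γ : Path.Homotopic.Quotient S.basePoint S.basePoint, IsEdge e γ :=
  IsArc.exists_mk _ (S.basePoint_eq (n := ⦋1⦌) _ _) (S.basePoint_eq (n := ⦋1⦌) _ _)

/-- The homotopy class of the loop given by an object of `S̃₁ C`. -/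
noncomputable def edgeClass (A : STilde S ⦋1⦌) :
    Path.Homotopic.Quotient S.basePoint S.basePoint := .mk (S.edgeLoop A)

lemma isEdge_edgeClass (A : STilde S ⦋1⦌) :
    IsEdge (S.simplex (n := ⦋1⦌) (ComposableArrows.mk₁ (𝟙 A))) (S.edgeClass A) :=
  isEdge_realizationPath (S.baseEdge A)

/-- The 2-simplex of the diagonal that is constant at `B` in the nerve direction has these three
flags as its edges. -/
lemma edgeClass_pull (B : STilde S ⦋2⦌) :
    S.edgeClass ((STilde.pull (edgeHom (n := ⦋2⦌) (i := (0 : Fin 3)) (j := (2 : Fin 3))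
      (by decide))).obj B) =
    (S.edgeClass ((STilde.pull (edgeHom (n := ⦋2⦌) (i := (0 : Fin 3)) (j := (1 : Fin 3))
      (by decide))).obj B)).trans
    (S.edgeClass ((STilde.pull (edgeHom (n := ⦋2⦌) (i := (1 : Fin 3)) (j := (2 : Fin 3))
      (by decide))).obj B)) := by
  have key : ∀ {i j : Fin 3} (h : i ≤ j), S.diag.map (edgeHom (n := ⦋2⦌) h).op
      (S.simplex (n := ⦋2⦌) ((Functor.const _).obj B)) =
      S.simplex (n := ⦋1⦌) (ComposableArrows.mk₁ (𝟙 ((STilde.pull (edgeHom (n := ⦋2⦌) h)).obj B))) :=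
    fun h => S.map_edgeHom_simplex (n := ⦋2⦌) _ h
  refine IsEdge.comp (ρ := S.simplex (n := ⦋2⦌) ((Functor.const _).obj B)) ?_ ?_ ?_
  all_goals
    rw [key]
    exact S.isEdge_edgeClass _

variable {S}

/-- Since ∅ is initial, the only object of `STilde S ⦋0⦌` has only one endomorphism. Restriction
along `b` thus trivializes `f`, and the edge is a degenerate vertex. -/
lemma eq_refl_of_factor (hS : Nonempty (IsInitial S.empty)) {A B : STilde S ⦋1⦌} (f : A ⟶ B)
    (a : ⦋1⦌ ⟶ ⦋0⦌) (b : ⦋0⦌ ⟶ ⦋1⦌) {γ : Path.Homotopic.Quotient S.basePoint S.basePoint}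
    (h : IsEdge (S.simplex (n := ⦋1⦌) (ComposableArrows.mk₁ ((STilde.pull (a ≫ b)).map f))) γ) :
    γ = .refl _ := by
  have hsub : ∀ X Y : STilde S ⦋0⦌, Subsingleton (X ⟶ Y) := by
    intro X Y
    obtain rfl := S.eq_flagZero X
    refine ⟨fun f g => STilde.Hom.ext (NatTrans.ext (funext fun a => ?_))⟩
    exact hS.some.hom_ext _ _
  have hF : ComposableArrows.mk₁ f ⋙ STilde.pull b = (Functor.const _).obj S.flagZero :=
    CategoryTheory.Functor.ext (fun _ => S.eq_flagZero _) (fun _ _ _ => (hsub _ _).elim _ _)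
  refine IsEdge.degenerate (v := S.simplex (n := ⦋0⦌) ((Functor.const _).obj S.flagZero))
    (f := a) ?_
  have h1 : S.diag.map a.op (S.simplex (n := ⦋0⦌) ((Functor.const _).obj S.flagZero)) =
      S.simplex (n := ⦋1⦌) (ComposableArrows.mk₁ ((STilde.pull (a ≫ b)).map f)) :=
    (congrArg (fun F => S.simplex (n := ⦋1⦌) (F ⋙ STilde.pull a)) hF.symm).trans
      (ComposableArrows.eq_mk₁_map (D := STilde S ⦋1⦌) _)
  rwa [h1]

/-- The triangle on `f`, `g` with flags degenerate along `σ 1` has edges `f`, a trivial one and `f ≫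
g`; along `σ 0` they are a trivial one, `g` and `f ≫ g`. -/
lemma isEdge_comp_eq (hS : Nonempty (IsInitial S.empty)) {A B D : STilde S ⦋1⦌} {f : A ⟶ B}
    {g : B ⟶ D} {α β γ : Path.Homotopic.Quotient S.basePoint S.basePoint}
    (hα : IsEdge (S.simplex (n := ⦋1⦌) (ComposableArrows.mk₁ f)) α)
    (hβ : IsEdge (S.simplex (n := ⦋1⦌) (ComposableArrows.mk₁ g)) β)
    (hγ : IsEdge (S.simplex (n := ⦋1⦌) (ComposableArrows.mk₁ (f ≫ g))) γ) : γ = α ∧ γ = β := by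
  have key : ∀ (s : ⦋2⦌ ⟶ ⦋1⦌) {i j : Fin 3} (h : i ≤ j),
      S.diag.map (edgeHom (n := ⦋2⦌) h).op
        (S.simplex (n := ⦋2⦌) (ComposableArrows.mk₂ f g ⋙ STilde.pull s)) =
      S.simplex (n := ⦋1⦌) (ComposableArrows.mk₁ ((STilde.pull (edgeHom (n := ⦋2⦌) h ≫ s)).map
        ((ComposableArrows.mk₂ f g).map (homOfLE h)))) :=
    fun s i j h => S.map_edgeHom_simplex (n := ⦋2⦌) _ h
  constructor
  · obtain ⟨δ, hδ⟩ := S.exists_isEdge (S.diag.map (edgeHom (n := ⦋2⦌) (i := (1 : Fin 3))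
      (j := (2 : Fin 3)) (by decide)).op
        (S.simplex (n := ⦋2⦌) (ComposableArrows.mk₂ f g ⋙ STilde.pull (SimplexCategory.σ 1))))
    have h := IsEdge.comp (α := α) (γ := γ) ?_ hδ ?_
    · rw [key] at hδ
      have hab : edgeHom (n := ⦋2⦌) (i := (1 : Fin 3)) (j := (2 : Fin 3)) (by decide) ≫
          SimplexCategory.σ 1 = SimplexCategory.σ 0 ≫ SimplexCategory.const ⦋0⦌ ⦋1⦌ 1 := by
        ext a : 3
        fin_cases a <;> rfl
      rw [hab] at hδ
      obtain rfl := eq_refl_of_factor hS _ _ _ hδ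
      exact h.trans (Path.Homotopic.Quotient.trans_refl _)
    · rw [key]
      have hab : edgeHom (n := ⦋2⦌) (i := (0 : Fin 3)) (j := (1 : Fin 3)) (by decide) ≫
          SimplexCategory.σ 1 = 𝟙 _ := by
        ext a : 3
        fin_cases a <;> rfl
      rw [hab]
      exact hα
    · rw [key]
      have hab : edgeHom (n := ⦋2⦌) (i := (0 : Fin 3)) (j := (2 : Fin 3)) (by decide) ≫
          SimplexCategory.σ 1 = 𝟙 _ := by
        ext a : 3
        fin_cases a <;> rfl
      rw [hab]
      exact hγ
  · obtain ⟨δ, hδ⟩ := S.exists_isEdge (S.diag.map (edgeHom (n := ⦋2⦌) (i := (0 : Fin 3))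
      (j := (1 : Fin 3)) (by decide)).op
        (S.simplex (n := ⦋2⦌) (ComposableArrows.mk₂ f g ⋙ STilde.pull (SimplexCategory.σ 0))))
    have h := IsEdge.comp (β := β) (γ := γ) hδ ?_ ?_
    · rw [key] at hδ
      have hab : edgeHom (n := ⦋2⦌) (i := (0 : Fin 3)) (j := (1 : Fin 3)) (by decide) ≫
          SimplexCategory.σ 0 = SimplexCategory.σ 0 ≫ SimplexCategory.const ⦋0⦌ ⦋1⦌ 0 := by
        ext a : 3
        fin_cases a <;> rfl
      rw [hab] at hδ
      obtain rfl := eq_refl_of_factor hS _ _ _ hδ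
      exact h.trans (Path.Homotopic.Quotient.refl_trans _)
    · rw [key]
      have hab : edgeHom (n := ⦋2⦌) (i := (1 : Fin 3)) (j := (2 : Fin 3)) (by decide) ≫
          SimplexCategory.σ 0 = 𝟙 _ := by
        ext a : 3
        fin_cases a <;> rfl
      rw [hab]
      exact hβ
    · rw [key]
      have hab : edgeHom (n := ⦋2⦌) (i := (0 : Fin 3)) (j := (2 : Fin 3)) (by decide) ≫
          SimplexCategory.σ 0 = 𝟙 _ := by
        ext a : 3
        fin_cases a <;> rfl
      rw [hab]
      exact hγ

lemma eq_edgeClass (hS : Nonempty (IsInitial S.empty)) {A B : STilde S ⦋1⦌} {f : A ⟶ B}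
    {γ : Path.Homotopic.Quotient S.basePoint S.basePoint}
    (h : IsEdge (S.simplex (n := ⦋1⦌) (ComposableArrows.mk₁ f)) γ) :
    γ = S.edgeClass A ∧ γ = S.edgeClass B :=
  ⟨(isEdge_comp_eq hS (S.isEdge_edgeClass A) h (by rwa [Category.id_comp])).1,
    (isEdge_comp_eq hS h (S.isEdge_edgeClass B) (by rwa [Category.comp_id])).2⟩

lemma edgeClass_eq_of_hom (hS : Nonempty (IsInitial S.empty)) {A B : STilde S ⦋1⦌} (f : A ⟶ B) :
    S.edgeClass A = S.edgeClass B := by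
  obtain ⟨γ, h⟩ := S.exists_isEdge (S.simplex (n := ⦋1⦌) (ComposableArrows.mk₁ f))
  exact (eq_edgeClass hS h).1.symm.trans (eq_edgeClass hS h).2

end SWData

/-! ### The shape of a flag of length two -/

namespace FlagIndex

lemma eq_mk_or {m : SimplexCategory} (p : FlagIndex m) :
    (∃ i, p = mk (le_refl i)) ∨ ∃ (i j : Fin (m.len + 1)) (h : i < j), p = mk h.le := by
  obtain ⟨⟨i, j⟩, h⟩ := p
  obtain h' | h' := h.eq_or_lt
  · exact .inl ⟨j, Subtype.ext (Prod.ext h' rfl)⟩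
  · exact .inr ⟨_, _, h', rfl⟩

/-- The entries of a flag of length two. -/
def shapeObj (i j : Fin 3) : WithInitial WalkingCospan :=
  match i, j with
  | 0, 1 => .of .left
  | 0, 2 => .of .one
  | 1, 2 => .of .right
  -- The diagonal entries. The pairs with `j < i` also land here but do not occur in `FlagIndex`.
  | _, _ => .star

instance (a b : WithInitial WalkingCospan) : Subsingleton (a ⟶ b) := by
  refine ⟨fun f g => ?_⟩
  cases a with
  | star => exact WithInitial.starInitial.hom_ext f g
  | of a =>
    cases b with
    | star => exact PEmpty.elim f
    | of b => exact Subsingleton.elim (α := (a ⟶ b)) f g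

lemma nonempty_hom : ∀ {i j i' j' : Fin 3}, i' ≤ i → j ≤ j' → i ≤ j →
    Nonempty (shapeObj i j ⟶ shapeObj i' j') := by
  intro i j i' j' h1 h2 h3
  fin_cases i <;> fin_cases j <;> first
  | exact ⟨WithInitial.starInitial.to _⟩
  | exact absurd h3 (by decide)
  | fin_cases i' <;> fin_cases j' <;> first
    | exact absurd h1 (by decide)
    | exact absurd h2 (by decide)
    | exact ⟨𝟙 _⟩
    | exact ⟨WithInitial.incl.map WalkingCospan.Hom.inl⟩
    | exact ⟨WithInitial.incl.map WalkingCospan.Hom.inr⟩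

/-- The shape of a flag of length two. -/
noncomputable def shape : FlagIndex ⦋2⦌ ⥤ WithInitial WalkingCospan where
  obj p := shapeObj p.1.1 p.1.2
  map {p _} f := (nonempty_hom (leOfHom f).1 (leOfHom f).2 p.2).some
  map_id _ := Subsingleton.elim _ _
  map_comp _ _ := Subsingleton.elim _ _

end FlagIndex

/-! ### Classes of objects in the fundamental group -/

namespace SWData

open Realization

variable {C : Type u} [Category.{v} C]

/-- Basic properties of subtraction sequences. -/
structure IsPresubtractive (S : SWData C) : Prop where
  isInitial : Nonempty (IsInitial S.empty)
  sub_cof : ∀ ⦃Z X Y : C⦄ (i : Z ⟶ X) (j : Y ⟶ X), S.sub i j → S.cof i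
  sub_of_isInitial_left : ∀ ⦃Z X Y : C⦄ (i : Z ⟶ X) (j : Y ⟶ X),
    Nonempty (IsInitial Z) → IsIso j → S.sub i j
  sub_of_isInitial_right : ∀ ⦃Z X Y : C⦄ (i : Z ⟶ X) (j : Y ⟶ X),
    IsIso i → Nonempty (IsInitial Y) → S.sub i j
  isPullback_of_sub : ∀ ⦃E Z X Y : C⦄ (i : Z ⟶ X) (j : Y ⟶ X) (a : E ⟶ Z) (b : E ⟶ Y),
    S.sub i j → Nonempty (IsInitial E) → IsPullback a b i j
  iso_weq : MorphismProperty.isomorphisms C ≤ S.weq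
  isPullback_of_weq : ∀ ⦃E E' X X' : C⦄ (f : X ⟶ X') (a : E ⟶ X) (e : E ⟶ E') (b : E' ⟶ X'),
    S.weq f → Nonempty (IsInitial E) → Nonempty (IsInitial E') → IsPullback a e f b
  -- The source of commutativity: one object is decomposed into `X` and `Y` in both orders.
  exists_sub_sub : ∀ X Y : C, ∃ (P : C) (i : X ⟶ P) (j : Y ⟶ P), S.sub i j ∧ S.sub j i

namespace IsPresubtractive

variable {S : SWData C} (hS : S.IsPresubtractive)
include hS

lemma isInitial_flag {m : SimplexCategory} (A : STilde S m) (i : Fin (m.len + 1)) :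
    Nonempty (IsInitial (A.flag.obj (FlagIndex.mk (le_refl i)))) :=
  ⟨hS.isInitial.some.ofIso (eqToIso (A.flag_empty i).symm)⟩

/-- The flag given by a subtraction sequence. -/
noncomputable def twoFlag {Z X Y : C} (i : Z ⟶ X) (j : Y ⟶ X) (hij : S.sub i j) : STilde S ⦋2⦌ :=
  have hE : ∀ a : Fin 3, Nonempty (IsInitial
      ((FlagIndex.shape ⋙ WithInitial.liftToInitial (cospan i j) hS.isInitial.some).obj
        (FlagIndex.mk (n := ⦋2⦌) (le_refl a)))) := fun a => by
    fin_cases a <;> exact hS.isInitial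
  have hid : ∀ {a : FlagIndex ⦋2⦌} (f : a ⟶ a), IsIso
      ((FlagIndex.shape ⋙ WithInitial.liftToInitial (cospan i j) hS.isInitial.some).map f) :=
    fun f => by
      rw [Subsingleton.elim f (𝟙 _)]
      infer_instance
  have hsub : ∀ {a b c : Fin 3} (hab : a ≤ b) (hbc : b ≤ c),
      S.sub ((FlagIndex.shape ⋙ WithInitial.liftToInitial (cospan i j) hS.isInitial.some).map
        (FlagIndex.right (n := ⦋2⦌) hab hbc))
      ((FlagIndex.shape ⋙ WithInitial.liftToInitial (cospan i j) hS.isInitial.some).map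
        (FlagIndex.up (n := ⦋2⦌) hab hbc)) := by
    intro a b c hab hbc
    obtain rfl | hab' := hab.eq_or_lt
    · exact hS.sub_of_isInitial_left _ _ (hE a) (hid _)
    obtain rfl | hbc' := hbc.eq_or_lt
    · exact hS.sub_of_isInitial_right _ _ (hid _) (hE b)
    obtain ⟨rfl, rfl, rfl⟩ : a = 0 ∧ b = 1 ∧ c = 2 := by
      revert a b c
      decide
    have h1 : FlagIndex.shape.map (FlagIndex.right (n := ⦋2⦌) hab hbc) =
        WithInitial.incl.map WalkingCospan.Hom.inl := Subsingleton.elim _ _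
    have h2 : FlagIndex.shape.map (FlagIndex.up (n := ⦋2⦌) hab hbc) =
        WithInitial.incl.map WalkingCospan.Hom.inr := Subsingleton.elim _ _
    rw [Functor.comp_map, Functor.comp_map, h1, h2]
    exact hij
  { flag := FlagIndex.shape ⋙ WithInitial.liftToInitial (cospan i j) hS.isInitial.some
    flag_empty := fun (a : Fin 3) => by fin_cases a <;> rfl
    flag_cof := fun hab hbc => hS.sub_cof _ _ (hsub hab hbc)
    flag_sub := fun hab hbc => hsub hab hbc
    flag_cart := fun {a b c d} hab hbc hcd => by
      have hcomm : ∀ F : FlagIndex ⦋2⦌ ⥤ C,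
        CommSq (F.map (FlagIndex.right hbc hcd)) (F.map (FlagIndex.up hab hbc))
          (F.map (FlagIndex.up hab (hbc.trans hcd)))
          (F.map (FlagIndex.right (hab.trans hbc) hcd)) :=
        fun F => ⟨by rw [← F.map_comp, ← F.map_comp]; exact congrArg F.map (Subsingleton.elim _ _)⟩
      obtain rfl | hab' := hab.eq_or_lt
      · have := hid (FlagIndex.up hab hbc)
        have := hid (FlagIndex.up hab (hbc.trans hcd))
        exact IsPullback.of_vert_isIso (hcomm _)
      obtain rfl | hcd' := hcd.eq_or_lt
      · have := hid (FlagIndex.right hbc hcd)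
        have := hid (FlagIndex.right (hab.trans hbc) hcd)
        exact IsPullback.of_horiz_isIso (hcomm _)
      obtain rfl | hbc' := hbc.eq_or_lt
      · exact (hS.isPullback_of_sub _ _ _ _ (hsub hab hcd) (hE b)).flip
      · rw [Fin.lt_def] at hab' hbc' hcd'
        have := d.2
        change d.1 < 3 at this
        omega }

/-- Apart from the entry in question all entries are initial, so the other components are forced and
natural. The cartesian squares either have identities as horizontal maps or initial objects as
left-hand corners of those maps. -/
lemma exists_hom {A B : STilde S ⦋1⦌} (f : A.flag.obj (FlagIndex.mk (i := 0) (j := 1) zero_le_one) ⟶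
      B.flag.obj (FlagIndex.mk (i := 0) (j := 1) zero_le_one)) (hf : S.weq f) :
    Nonempty (A ⟶ B) := by
  have hp : ∀ p : FlagIndex ⦋1⦌, (∃ i, p = .mk (le_refl i)) ∨
      p = FlagIndex.mk (i := (0 : Fin 2)) (j := (1 : Fin 2)) zero_le_one := fun p => by
    obtain h | ⟨(i : Fin 2), (j : Fin 2), h, rfl⟩ := FlagIndex.eq_mk_or p
    · exact .inl h
    · obtain ⟨rfl, rfl⟩ : i = 0 ∧ j = 1 := by
        revert i j
        decide
      exact .inr rfl
  have hid : ∀ (F : FlagIndex ⦋1⦌ ⥤ C) {a : FlagIndex ⦋1⦌} (f : a ⟶ a), IsIso (F.map f) :=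
    fun F _ f => by
      rw [Subsingleton.elim f (𝟙 _)]
      infer_instance
  have hg : ∀ p : FlagIndex ⦋1⦌, ∃ g : A.flag.obj p ⟶ B.flag.obj p, S.weq g ∧
      ∀ h : p = FlagIndex.mk (i := (0 : Fin 2)) (j := (1 : Fin 2)) zero_le_one,
        g = eqToHom (by rw [h]) ≫ f ≫ eqToHom (by rw [h]) := fun p => by
    obtain ⟨i, rfl⟩ | rfl := hp p
    · have hA := (hS.isInitial_flag A i).some
      have hB := (hS.isInitial_flag B i).some
      refine ⟨(hA.uniqueUpToIso hB).hom, hS.iso_weq _ (.infer_property _), fun h => ?_⟩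
      exact hA.hom_ext _ _
    · exact ⟨f, hf, by simp⟩
  choose g hg hgf using hg
  have hnat : ∀ ⦃p q : FlagIndex ⦋1⦌⦄ (k : p ⟶ q), A.flag.map k ≫ g q = g p ≫ B.flag.map k := by
    intro p q k
    obtain ⟨i, rfl⟩ | rfl := hp p
    · exact (hS.isInitial_flag A i).some.hom_ext _ _
    · obtain rfl : q = FlagIndex.mk (i := (0 : Fin 2)) (j := (1 : Fin 2)) zero_le_one := by
        obtain ⟨i, rfl⟩ | h := hp q
        · have h := leOfHom k
          exact absurd (le_trans h.2 h.1) (by decide : ¬ (1 : Fin 2) ≤ 0)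
        · exact h
      rw [Subsingleton.elim k (𝟙 _)]
      simp
  refine ⟨⟨⟨g, hnat⟩, fun {i j k} hij hjk => ?_, hg⟩⟩
  obtain rfl | hij' := hij.eq_or_lt
  · exact hS.isPullback_of_weq _ _ _ _ (hg _) (hS.isInitial_flag A i) (hS.isInitial_flag B i)
  obtain rfl | hjk' := hjk.eq_or_lt
  · have := hid A.flag (FlagIndex.right hij hjk)
    have := hid B.flag (FlagIndex.right hij hjk)
    exact IsPullback.of_horiz_isIso ⟨hnat _⟩
  · rw [Fin.lt_def] at hij' hjk'
    have := k.2
    change k.1 < 2 at this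
    omega

/-- The flag given by an object. -/
noncomputable def oneFlag (X : C) : STilde S ⦋1⦌ :=
  (STilde.pull (edgeHom (n := ⦋2⦌) (i := (0 : Fin 3)) (j := (1 : Fin 3)) (by decide))).obj
    (hS.twoFlag (𝟙 X) (hS.isInitial.some.to X)
      (hS.sub_of_isInitial_right _ _ inferInstance hS.isInitial))

/-- The class in the fundamental group given by an object. -/
noncomputable def objClass (X : C) : Path.Homotopic.Quotient S.basePoint S.basePoint :=
  S.edgeClass (hS.oneFlag X)

lemma edgeClass_eq_of_weq {A B : STilde S ⦋1⦌}
    (f : A.flag.obj (FlagIndex.mk (i := 0) (j := 1) zero_le_one) ⟶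
      B.flag.obj (FlagIndex.mk (i := 0) (j := 1) zero_le_one)) (hf : S.weq f) :
    S.edgeClass A = S.edgeClass B :=
  edgeClass_eq_of_hom hS.isInitial (hS.exists_hom f hf).some

lemma edgeClass_eq_objClass (A : STilde S ⦋1⦌) :
    S.edgeClass A = hS.objClass (A.flag.obj (FlagIndex.mk (i := 0) (j := 1) zero_le_one)) :=
  hS.edgeClass_eq_of_weq (B := hS.oneFlag _) (𝟙 _) (S.weq_mult.id_mem _)

lemma objClass_eq_of_weq {X X' : C} (f : X ⟶ X') (hf : S.weq f) :
    hS.objClass X = hS.objClass X' :=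
  hS.edgeClass_eq_of_weq (A := hS.oneFlag X) (B := hS.oneFlag X') f hf

lemma objClass_eq_trans {Z X Y : C} (i : Z ⟶ X) (j : Y ⟶ X) (hij : S.sub i j) :
    hS.objClass X = (hS.objClass Z).trans (hS.objClass Y) := by
  have := S.edgeClass_pull (hS.twoFlag i j hij)
  simp only [hS.edgeClass_eq_objClass] at this
  exact this

lemma trans_comm_objClass (X Y : C) :
    (hS.objClass X).trans (hS.objClass Y) = (hS.objClass Y).trans (hS.objClass X) := by
  obtain ⟨P, i, j, h, h'⟩ := hS.exists_sub_sub X Y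
  rw [← hS.objClass_eq_trans i j h, ← hS.objClass_eq_trans j i h']

end IsPresubtractive

end SWData

/-! ### Components of loop spaces -/

lemma Path.joined_iff_homotopic {X : Type*} [TopologicalSpace X] {x y : X} {p q : Path x y} :
    Joined p q ↔ p.Homotopic q := by
  constructor
  · rintro ⟨h⟩
    exact ⟨{
      toFun := fun x => h x.1 x.2
      continuous_toFun := ContinuousEval.continuous_eval.comp
        ((h.continuous.comp continuous_fst).prodMk continuous_snd)
      map_zero_left := fun s => by simp
      map_one_left := fun s => by simp
      prop' := by
        rintro t _ (rfl | rfl)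
        · exact (h t).source.trans p.source.symm
        · exact (h t).target.trans p.target.symm }⟩
  · rintro ⟨H⟩
    exact ⟨⟨⟨H.eval, continuous_induced_rng.2
      (ContinuousMap.continuous_of_continuous_uncurry _ H.continuous)⟩, H.eval_zero, H.eval_one⟩⟩

lemma Path.Homotopic.Quotient.trans_trans_comm {X : Type*} [TopologicalSpace X] {x : X}
    {a b c : Path.Homotopic.Quotient x x} (h : a.trans c = c.trans a) (h' : b.trans c = c.trans b) :
    (a.trans b).trans c = c.trans (a.trans b) := by
  rw [trans_assoc, h', ← trans_assoc, h, trans_assoc]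

lemma Path.Homotopic.Quotient.symm_trans_comm {X : Type*} [TopologicalSpace X] {x : X}
    {a b : Path.Homotopic.Quotient x x} (h : a.trans b = b.trans a) :
    a.symm.trans b = b.trans a.symm := by
  have := congrArg (fun c => (a.symm.trans c).trans a.symm) h
  simp only [trans_assoc, trans_symm, trans_refl] at this
  rw [← trans_assoc, ← trans_assoc, symm_trans, refl_trans] at this
  exact this.symm

/-- The set of path components of a loop space is the fundamental group. -/
noncomputable def zerothHomotopyLoopSpaceEquiv (X : Type*) [TopologicalSpace X] (x : X) :
    ZerothHomotopy (LoopSpace X x) ≃ Path.Homotopic.Quotient x x :=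
  Quotient.congr (Equiv.refl _) fun _ _ => Path.joined_iff_homotopic

/-! ### The isomorphism with the Grothendieck group -/

namespace SWData

open Realization

variable {C : Type u} [Category.{v} C] {S : SWData C}

lemma k0Class_eq_of_weq {X X' : C} (f : X ⟶ X') (hf : S.weq f) : S.k0Class X = S.k0Class X' := by
  refine QuotientAddGroup.eq.2 ?_
  rw [neg_add_eq_sub, ← neg_mem_iff, neg_sub]
  exact AddSubgroup.subset_closure (.inl ⟨X, X', f, hf, rfl⟩)

lemma k0Class_eq_add {Z X Y : C} (i : Z ⟶ X) (j : Y ⟶ X) (h : S.sub i j) :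
    S.k0Class X = S.k0Class Z + S.k0Class Y := by
  refine eq_of_sub_eq_zero ((QuotientAddGroup.eq_zero_iff _).2 ?_ : QuotientAddGroup.mk _ = (0 : S.K0))
  exact AddSubgroup.subset_closure (.inr ⟨Z, X, Y, i, j, h, rfl⟩)

/-- In a 2-simplex the edges 01 and 02 have source flags cut out of `F.obj 0`, but the edge 12 has
one cut out of `F.obj 1`. The weak equivalence between the two entries at (1, 2) reconciles them. -/
lemma isAdditive_k0Class : IsAdditive (K := S.diag) (fun e : S.diag _⦋1⦌ =>
    S.k0Class ((Functor.obj (C := Fin 2) (D := STilde S ⦋1⦌) e 0).flag.obj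
      (FlagIndex.mk (i := 0) (j := 1) zero_le_one))) := by
  intro ρ
  let F : Fin 3 ⥤ STilde S ⦋2⦌ := ρ
  let f : F.obj 0 ⟶ F.obj 1 := F.map (homOfLE (by decide))
  have h1 := k0Class_eq_add _ _ ((F.obj 0).flag_sub (i := (0 : Fin 3)) (j := (1 : Fin 3))
    (k := (2 : Fin 3)) (by decide) (by decide))
  rw [k0Class_eq_of_weq _ (f.weq (FlagIndex.mk (n := ⦋2⦌) (i := (1 : Fin 3)) (j := (2 : Fin 3))
    (by decide)))] at h1
  exact h1

theorem IsPresubtractive.piZeroKSpaceEqKZero (hS : S.IsPresubtractive) :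
    S.PiZeroKSpaceEqKZero := by
  have hcomm : ∀ a b : Path.Homotopic.Quotient S.basePoint S.basePoint,
      a.trans b = b.trans a := by
    -- The classes commuting with `b` are closed under concatenation and inversion, so generators
    -- suffice; this is used once for each of the two arguments.
    have hind : ∀ b : Path.Homotopic.Quotient S.basePoint S.basePoint,
        (∀ X, (hS.objClass X).trans b = b.trans (hS.objClass X)) →
        ∀ a, a.trans b = b.trans a := fun b hb => by
      refine loop_induction (K := S.diag) S.basePoint_eq ?_ (fun p q hp hq => ?_)
        (fun p hp => Path.Homotopic.Quotient.symm_trans_comm hp) fun e γ he => ?_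
      · exact (Path.Homotopic.Quotient.refl_trans _).trans (Path.Homotopic.Quotient.trans_refl _).symm
      · exact Path.Homotopic.Quotient.trans_trans_comm hp hq
      · obtain ⟨A, B, f, rfl⟩ := S.edge_surjective e
        obtain rfl := (eq_edgeClass hS.isInitial he).1
        rw [hS.edgeClass_eq_objClass]
        exact hb _
    exact fun a b => hind b (fun X => (hind _ (fun Y => hS.trans_comm_objClass Y X) b).symm) a
  let _ : CommGroup (FundamentalGroup S.wSTildeSpace S.basePoint) :=
    { (inferInstance : Group (FundamentalGroup S.wSTildeSpace S.basePoint)) with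
      mul_comm := fun a b => hcomm b a }
  obtain ⟨Φ, hΦ, hΦe⟩ := exists_hom_of_isAdditive (K := S.diag) S.basePoint_eq
    (isAdditive_k0Class (S := S))
  have hΦobj : ∀ A, Φ (S.edgeClass A) = S.k0Class (A.flag.obj
      (FlagIndex.mk (i := 0) (j := 1) zero_le_one)) := fun A => hΦe _ _ (S.isEdge_edgeClass A)
  let Ψ' : FreeAbelianGroup C →+ Additive (FundamentalGroup S.wSTildeSpace S.basePoint) :=
    FreeAbelianGroup.lift fun X => Additive.ofMul (hS.objClass X)
  have hΨ' : ∀ X, Ψ' (.of X) = Additive.ofMul (hS.objClass X) :=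
    fun X => FreeAbelianGroup.lift_apply_of _ _
  let Ψ : S.K0 →+ Additive (FundamentalGroup S.wSTildeSpace S.basePoint) :=
    QuotientAddGroup.lift _ Ψ' <| (AddSubgroup.closure_le _).2 <| by
      rintro r (⟨X, X', f, hf, rfl⟩ | ⟨Z, X, Y, i, j, h, rfl⟩)
      · change Ψ' _ = 0
        rw [map_sub, hΨ', hΨ', hS.objClass_eq_of_weq f hf, sub_self]
      · change Ψ' _ = 0
        rw [map_sub, map_add, hΨ', hΨ', hΨ', sub_eq_zero, hS.objClass_eq_trans i j h,
          hcomm]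
        rfl
  let Φ' : Additive (FundamentalGroup S.wSTildeSpace S.basePoint) →+ S.K0 :=
    AddMonoidHom.mk' (fun a => Φ a.toMul) fun a b => (hΦ b.toMul a.toMul).trans (add_comm _ _)
  have h1 : Φ'.comp Ψ = AddMonoidHom.id _ := by
    refine QuotientAddGroup.addMonoidHom_ext _ (FreeAbelianGroup.lift_ext _ _ fun X => ?_)
    change Φ (Ψ' (.of X)).toMul = _
    rw [hΨ']
    exact hΦobj _
  -- The other composite is the identity on classes of edges, and these generate.
  have h2 : ∀ a : Path.Homotopic.Quotient S.basePoint S.basePoint,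
      Ψ (Φ a) = Additive.ofMul a := by
    refine loop_induction (K := S.diag) S.basePoint_eq ?_ (fun p q hp hq => ?_)
      (fun p hp => ?_) fun e γ he => ?_
    · exact (congrArg Ψ (map_zero Φ')).trans (map_zero Ψ)
    · rw [hΦ, map_add, hp, hq, add_comm]
      rfl
    · have h : Φ p.symm + Φ p = 0 := by
        rw [← hΦ]
        exact (congrArg Φ (Path.Homotopic.Quotient.symm_trans p)).trans (map_zero Φ')
      rw [eq_neg_of_add_eq_zero_left h, map_neg, hp]
      rfl
    · obtain ⟨A, B, f, rfl⟩ := S.edge_surjective e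
      obtain rfl := (eq_edgeClass hS.isInitial he).1
      rw [hΦobj, hS.edgeClass_eq_objClass]
      exact hΨ' _
  refine ⟨(zerothHomotopyLoopSpaceEquiv _ _).trans ⟨Φ, fun x => (Ψ x).toMul, h2,
    fun x => DFunLike.congr_fun h1 x⟩, fun γ δ => ?_, fun A => ?_⟩
  · exact hΦ (.mk γ) (.mk δ)
  · exact hΦobj A

end SWData

/-! ### SW-categories -/

namespace SWData

variable {C : Type u} [Category.{v} C] {S : SWData C}

/-- A coproduct with an initial object is the other summand. -/
lemma IsCategoryWithSubtraction.sub_of_isInitial_left (h : S.IsCategoryWithSubtraction) {Z X Y : C}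
    (i : Z ⟶ X) (j : Y ⟶ X) (hZ : IsInitial Z) [IsIso j] : S.sub i j :=
  h.sub_coprod (BinaryCofan.mk i j) ⟨BinaryCofan.IsColimit.mk _ (fun _ g => show X ⟶ _ from inv j ≫ g)
    (fun _ _ => hZ.hom_ext _ _) (fun _ _ => IsIso.hom_inv_id_assoc j _)
    (fun _ _ _ _ hm => (IsIso.eq_inv_comp j).2 hm)⟩

lemma IsCategoryWithSubtraction.sub_of_isInitial_right (h : S.IsCategoryWithSubtraction)
    {Z X Y : C} (i : Z ⟶ X) (j : Y ⟶ X) (hY : IsInitial Y) [IsIso i] : S.sub i j :=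
  h.sub_coprod (BinaryCofan.mk i j) ⟨BinaryCofan.IsColimit.mk _ (fun f _ => show X ⟶ _ from inv i ≫ f)
    (fun _ _ => IsIso.hom_inv_id_assoc i _) (fun _ _ => hY.hom_ext _ _)
    (fun _ _ _ hm _ => (IsIso.eq_inv_comp i).2 hm)⟩

/-- Base change of the subtraction sequence `E' ⟶ X' ⟵ X'` along `f` gives a complement of the
identity of `X`. Such a complement is unique, and `E` is one. -/
lemma IsCategoryWithSubtraction.isPullback_of_isInitial (h : S.IsCategoryWithSubtraction)
    {E E' X X' : C} (f : X ⟶ X') (a : E ⟶ X) (e : E ⟶ E') (b : E' ⟶ X') (hE : IsInitial E)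
    (hE' : IsInitial E') : IsPullback a e f b := by
  have hb := h.sub_of_isInitial_left b (𝟙 X') hE'
  have := h.cof_hasPullback b f (h.sub_cof _ _ hb)
  have := hasPullback_symmetry b f
  have h1 := h.sub_baseChange b (𝟙 X') f (pullback.fst f b) (pullback.snd f b) (𝟙 X) f hb
    (IsPullback.of_hasPullback f b) IsPullback.of_id_fst
  obtain ⟨k, hk, -⟩ := h.unique_of_fib _ _ _ (h.sub_of_isInitial_left a (𝟙 X) hE) h1
  exact IsPullback.of_iso_pullback ⟨hE.hom_ext _ _⟩ k hk (hE.hom_ext _ _)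

lemma IsSWCategory.isPresubtractive (h : S.IsSWCategory) : S.IsPresubtractive where
  isInitial := h.isInitial
  sub_cof := h.sub_cof
  sub_of_isInitial_left := fun _ _ _ i j ⟨hZ⟩ _ => h.sub_of_isInitial_left i j hZ
  sub_of_isInitial_right := fun _ _ _ i j _ ⟨hY⟩ => h.sub_of_isInitial_right i j hY
  isPullback_of_sub := fun _ _ _ _ i j a b hij ⟨hE⟩ => h.isPullback_of_sub i j hij hE a b
  iso_weq := h.iso_weq
  isPullback_of_weq := fun _ _ _ _ f a e b _ ⟨hE⟩ ⟨hE'⟩ => h.isPullback_of_isInitial f a e b hE hE'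
  exists_sub_sub X Y := by
    obtain ⟨hE⟩ := h.isInitial
    have hX := h.sub_cof _ _ (h.sub_of_isInitial_left (hE.to X) (𝟙 X) hE)
    have hY := h.sub_cof _ _ (h.sub_of_isInitial_left (hE.to Y) (𝟙 Y) hE)
    have := h.cof_hasPushout _ _ hX hY
    have hP := IsPushout.of_hasPushout (hE.to X) (hE.to Y)
    -- A pushout over the initial object is a coproduct, and this description is symmetric in the
    -- summands.
    have key : ∀ {X Y P : C} {i : X ⟶ P} {j : Y ⟶ P}, IsPushout (hE.to X) (hE.to Y) i j →
        S.sub i j := fun {X Y P i j} hP =>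
      h.sub_coprod (BinaryCofan.mk i j) ⟨BinaryCofan.IsColimit.mk _
        (fun f g => hP.desc f g (hE.hom_ext _ _)) (fun f g => hP.inl_desc _ _ _)
        (fun f g => hP.inr_desc _ _ _)
        (fun f g m h1 h2 => hP.hom_ext (by rw [hP.inl_desc]; exact h1)
          (by rw [hP.inr_desc]; exact h2))⟩
    exact ⟨_, _, _, key hP, key hP.flip⟩

end SWData

/-! ### Varieties over a scheme -/

lemma CategoryTheory.IsPullback.of_forall_isInitial {C : Type*} [Category* C] {E X Y Z : C}
    {a : E ⟶ X} {b : E ⟶ Y} {f : X ⟶ Z} {g : Y ⟶ Z} (hE : IsInitial E)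
    (h : ∀ ⦃W : C⦄ (p : W ⟶ X) (q : W ⟶ Y), p ≫ f = q ≫ g → Nonempty (IsInitial W)) :
    IsPullback a b f g :=
  ⟨⟨hE.hom_ext _ _⟩, ⟨PullbackCone.IsLimit.mk _
    (fun s => (h s.fst s.snd s.condition).some.to E)
    (fun s => (h s.fst s.snd s.condition).some.hom_ext _ _)
    (fun s => (h s.fst s.snd s.condition).some.hom_ext _ _)
    (fun s _ _ _ => (h s.fst s.snd s.condition).some.hom_ext _ _)⟩⟩

namespace AlgebraicGeometry

/-- The image is the complement of the other summand, which is open. -/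
instance isClosedImmersion_coprod_inl (X Y : Scheme.{u}) :
    IsClosedImmersion (coprod.inl : X ⟶ X ⨿ Y) := by
  refine .of_isPreimmersion _ ?_
  rw [← (isCompl_range_inl_inr X Y).symm.compl_eq]
  exact (coprod.inr : Y ⟶ X ⨿ Y).isOpenEmbedding.isOpen_range.isClosed_compl

instance isClosedImmersion_coprod_inr (X Y : Scheme.{u}) :
    IsClosedImmersion (coprod.inr : Y ⟶ X ⨿ Y) := by
  refine .of_isPreimmersion _ ?_
  rw [← (isCompl_range_inl_inr X Y).compl_eq]
  exact (coprod.inl : X ⟶ X ⨿ Y).isOpenEmbedding.isOpen_range.isClosed_compl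

end AlgebraicGeometry

namespace Var

variable {X : Scheme.{w}}

lemma isInitial_of_isEmpty (Y : Var X) (hY : IsEmpty Y.obj.left) : Nonempty (IsInitial Y) :=
  ⟨IsInitial.ofUniqueHom (fun Z => ObjectProperty.homMk
      (Over.homMk (isInitialOfIsEmpty.to _) (isInitialOfIsEmpty.hom_ext _ _)))
    (fun Z m => by
      ext : 2
      exact isInitialOfIsEmpty.hom_ext _ _)⟩

lemma isEmpty_of_hom {Y Z : Var X} (f : Y ⟶ Z) (hZ : IsEmpty Z.obj.left) : IsEmpty Y.obj.left :=
  ⟨fun y => hZ.elim (f.hom.left y)⟩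

lemma isEmpty_of_isInitial {Y : Var X} (hY : IsInitial Y) : IsEmpty Y.obj.left :=
  isEmpty_of_hom (hY.to (Var.empty X)) (inferInstanceAs (IsEmpty (∅ : Scheme.{w})))

/-- The disjoint union of two varieties. -/
noncomputable def coprod (Y Z : Var X) : Var X where
  obj := Over.mk (Limits.coprod.desc Y.obj.hom Z.obj.hom)
  property := by
    -- Factor through the fold map of `X`: the first factor is treated by locality on the target,
    -- and the fold map has all three properties.
    have h : Limits.coprod.desc Y.obj.hom Z.obj.hom =
        coprod.map Y.obj.hom Z.obj.hom ≫ Limits.coprod.desc (𝟙 X) (𝟙 X) := by simp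
    obtain ⟨hY₁, hY₂, hY₃⟩ := Y.property
    obtain ⟨hZ₁, hZ₂, hZ₃⟩ := Z.property
    have := HasRingHomProperty.instIsZariskiLocalAtTarget @LocallyOfFiniteType.{w}
    have : IsZariskiLocalAtTarget @QuasiCompact.{w} :=
      @HasAffineProperty.instIsZariskiLocalAtTarget _ _
        instHasAffinePropertyQuasiCompactCompactSpaceCarrierCarrierCommRingCat
    have h₁ := IsZariskiLocalAtTarget.coprodMap (P := @LocallyOfFiniteType) _ _ hY₁ hZ₁
    have h₂ := IsZariskiLocalAtTarget.coprodMap (P := @QuasiCompact) _ _ hY₂ hZ₂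
    have h₃ := IsZariskiLocalAtTarget.coprodMap (P := @IsSeparated) _ _ hY₃ hZ₃
    dsimp only [isVariety, Over.mk_hom]
    rw [h]
    exact ⟨inferInstance, inferInstance, inferInstance⟩

lemma isPresubtractive (X : Scheme.{w}) : (varSWData X).IsPresubtractive where
  isInitial := isInitial_of_isEmpty _ (inferInstanceAs (IsEmpty (∅ : Scheme.{w})))
  sub_cof _ _ _ _ _ h := h.1
  sub_of_isInitial_left := by
    rintro Z Y Y' i j ⟨hZ⟩ hj
    have : IsEmpty ((Var.forget X).obj Z) := isEmpty_of_isInitial hZ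
    refine ⟨inferInstance, inferInstance, ?_⟩
    rw [Set.range_eq_empty ((Var.forget X).map i),
      Set.range_eq_univ.2 ((Var.forget X).map j).surjective]
    exact isCompl_bot_top
  sub_of_isInitial_right := by
    rintro Z Y Y' i j hi ⟨hY⟩
    have : IsEmpty ((Var.forget X).obj Y') := isEmpty_of_isInitial hY
    refine ⟨inferInstance, inferInstance, ?_⟩
    rw [Set.range_eq_empty ((Var.forget X).map j),
      Set.range_eq_univ.2 ((Var.forget X).map i).surjective]
    exact isCompl_top_bot
  isPullback_of_sub := by
    rintro E Z Y Y' i j a b ⟨-, -, h⟩ ⟨hE⟩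
    -- A point of `W` would give a common point of the two disjoint ranges; so `W` is empty and
    -- hence initial.
    refine IsPullback.of_forall_isInitial hE fun W p q hpq => isInitial_of_isEmpty _ ⟨fun x => ?_⟩
    refine Set.disjoint_left.1 h.disjoint ⟨p.hom.left x, rfl⟩ ⟨q.hom.left x, ?_⟩
    exact congrArg (fun f : W ⟶ Y => f.hom.left x) hpq.symm
  iso_weq := le_rfl
  isPullback_of_weq := by
    rintro E E' Y Y' f a e b - ⟨hE⟩ ⟨hE'⟩
    exact IsPullback.of_forall_isInitial hE fun W p q _ =>
      isInitial_of_isEmpty _ (isEmpty_of_hom q (isEmpty_of_isInitial hE'))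
  exists_sub_sub Y Z := by
    refine ⟨coprod Y Z, ObjectProperty.homMk (Over.homMk coprod.inl (coprod.inl_desc _ _)),
      ObjectProperty.homMk (Over.homMk coprod.inr (coprod.inr_desc _ _)), ?_, ?_⟩
    · exact ⟨isClosedImmersion_coprod_inl _ _,
        inferInstanceAs (IsOpenImmersion (coprod.inr : Z.obj.left ⟶ Y.obj.left ⨿ Z.obj.left)),
        isCompl_range_inl_inr _ _⟩
    · exact ⟨isClosedImmersion_coprod_inr _ _,
        inferInstanceAs (IsOpenImmersion (coprod.inl : Y.obj.left ⟶ Y.obj.left ⨿ Z.obj.left)),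
        (isCompl_range_inl_inr _ _).symm⟩

end Var

theorem mainTheorem4 :
    (∀ (C : Type u) [Category.{v} C] (S : SWData C),
      S.IsSWCategory → S.PiZeroKSpaceEqKZero) ∧
    (∀ X : Scheme.{w}, (varSWData X).PiZeroKSpaceEqKZero) :=
  ⟨fun _ _ _ hS => hS.isPresubtractive.piZeroKSpaceEqKZero,
    fun X => (Var.isPresubtractive X).piZeroKSpaceEqKZero⟩
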